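/- Let $k$ be a perfect field and let $S$ be a Severi--Brauer surface over $k$, i.e. a smooth projective surface over $k$ with $S_{\bar k}\simeq \mathbb P^2_{\bar k}$. Let $\mathrm{Aut}_k(S)$ be its group of $k$-automorphisms. For an extension $L/k$, $\mathrm{Gal}(L/k)$ acts on $S_L$ and on $\mathbb P^2_L$ through the second factor of $S\times_k L$, resp. on the coordinates; for a matrix $A$ over $L$ let $A^g$ be the matrix obtained by applying $g$ to the entries of $A$, and for $A\in \mathrm{GL}_3(L)$ let $[A]$ be the automorphism $x\mapsto Ax$ of $\mathbb P^2_L$. (0) There is a finite Galois extension $L/k$ with $S_L\simeq\mathbb P^2_L$. (1) Let $L/k$ be any finite Galois extension and $\varphi: S_L\to\mathbb P^2_L$ any $L$-isomorphism. There are matrices $A_g\in \mathrm{GL}_3(L)$, $g\in \mathrm{Gal}(L/k)$, such that $\varphi\circ g\circ\varphi^{-1}=[A_g]\circ g$ for all $g$. For every choice of such $A_g$ and every $\alpha\in \mathrm{Aut}_k(S)$ there is a matrix $A\in \mathrm{GL}_3(L)$ with $$[A]=\varphi\circ\alpha\circ\varphi^{-1}\quad\text{and}\quad A^g=A_g^{-1}AA_g\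 \text{ for all } g\in \mathrm{Gal}(L/k),$$ and the matrices with these two properties are exactly the multiples $cA$ with $c\in k^*$. Call them the affine representants of $\alpha$ with respect to $L,\varphi,(A_g)$. (2) The determinant of every affine representant $A$ of $\alpha$ lies in $k^*$, and its class in $k^*/(k^*)^3$ depends only on $\alpha$: it does not depend on $A$, the field $L$, the isomorphism $\varphi$ or the matrices $A_g$. The resulting map $\det:\mathrm{Aut}_k(S)\to k^*/(k^*)^3$, $\alpha\mapsto \det(A)\,(k^*)^3$, is a group homomorphism. Equivalently, there is exactly one group homomorphism $\det: \mathrm{Aut}_k(S)\to k^*/(k^*)^3$ such that, for all $L,\varphi,(A_g)$ as in (1), all $\alpha$ and all affine representants $A$ of $\alpha$, $\det(A)\in k^*$ and $\det(\alpha)$ is the class of $\det(A)$. -/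

import Mathlib

open CategoryTheory AlgebraicGeometry

universe u

noncomputable section

namespace SeveriBrauer

/-! ### Projective space over a field -/

/-- The standard grading of the polynomial ring `K[x₀, …, xₙ]` by degree. -/
abbrev grading (n : ℕ) (K : Type u) [Field K] :
    ℕ → Submodule K (MvPolynomial (Fin (n + 1)) K) :=
  MvPolynomial.homogeneousSubmodule (Fin (n + 1)) K

instance gradingGradedAlgebra (n : ℕ) (K : Type u) [Field K] : GradedAlgebra (grading n K) :=
  MvPolynomial.gradedAlgebra

/-- Projective space `ℙⁿ_K = Proj K[x₀, …, xₙ]`, as a scheme over `Spec K`. -/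
def projectiveSpace (n : ℕ) (K : Type u) [Field K] : Over (Spec (CommRingCat.of K)) :=
  Over.mk (Y := Proj (grading n K)) (Proj.toSpecZero (grading n K) ≫
    Spec.map (CommRingCat.ofHom (algebraMap K (grading n K 0))))

/-- The projective plane over `K`. -/
abbrev projectivePlane (K : Type u) [Field K] : Over (Spec (CommRingCat.of K)) :=
  projectiveSpace 2 K

/-- A graded ring endomorphism with a graded right inverse satisfies the condition
under which `Proj` is functorial. -/
theorem irrelevant_le_map {K : Type u} [Field K] {n : ℕ}
    (f f' : grading n K →+*ᵍ grading n K) (h : ∀ x, f (f' x) = x) :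
    HomogeneousIdeal.irrelevant (grading n K) ≤
      (HomogeneousIdeal.irrelevant (grading n K)).map f := by
  rw [HomogeneousIdeal.irrelevant_le]
  intro i hi x hx
  change x ∈ ((HomogeneousIdeal.irrelevant (grading n K)).map f).toIdeal
  rw [HomogeneousIdeal.toIdeal_map]
  have hx' : f' x ∈ (HomogeneousIdeal.irrelevant (grading n K)).toIdeal :=
    HomogeneousIdeal.mem_irrelevant_of_mem (grading n K) hi (f'.map_mem hx)
  have := Ideal.mem_map_of_mem f hx'
  rwa [h] at this

/-- For a field automorphism `g` of `K`, the graded ring automorphism of `K[x₀, …, xₙ]` which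
applies `g` to the coefficients. -/
def coeffHom (n : ℕ) {K : Type u} [Field K] (g : K ≃+* K) : grading n K →+*ᵍ grading n K where
  __ := MvPolynomial.map (σ := Fin (n + 1)) (g : K →+* K)
  map_mem := fun {_ _} hx => MvPolynomial.IsHomogeneous.map hx _

theorem coeffHom_apply (n : ℕ) {K : Type u} [Field K] (g : K ≃+* K)
    (p : MvPolynomial (Fin (n + 1)) K) :
    coeffHom n g p = MvPolynomial.map (g : K →+* K) p := rfl

theorem coeffHom_symm (n : ℕ) {K : Type u} [Field K] (g : K ≃+* K)
    (p : MvPolynomial (Fin (n + 1)) K) : coeffHom n g (coeffHom n g.symm p) = p := by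
  rw [coeffHom_apply, coeffHom_apply, MvPolynomial.map_map]
  simp [MvPolynomial.map_id]

/-- For a square matrix `A`, the graded `K`-algebra endomorphism `xᵢ ↦ ∑ⱼ Aᵢⱼ xⱼ` of
`K[x₀, …, xₙ]`. -/
def linearHom {n : ℕ} {K : Type u} [Field K] (A : Matrix (Fin (n + 1)) (Fin (n + 1)) K) :
    grading n K →+*ᵍ grading n K where
  __ := (MvPolynomial.aeval (R := K) (fun i => ∑ j, MvPolynomial.C (A i j) * MvPolynomial.X j :
      Fin (n + 1) → MvPolynomial (Fin (n + 1)) K)).toRingHom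
  map_mem := fun {m _} hx => by
    have := MvPolynomial.IsHomogeneous.aeval (n := 1) hx
      (fun i => ∑ j, MvPolynomial.C (A i j) * MvPolynomial.X j :
        Fin (n + 1) → MvPolynomial (Fin (n + 1)) K)
      (fun i => MvPolynomial.IsHomogeneous.sum _ _ _ fun j _ =>
        MvPolynomial.isHomogeneous_C_mul_X _ _)
    rw [one_mul] at this
    exact this

theorem linearHom_apply {n : ℕ} {K : Type u} [Field K]
    (A : Matrix (Fin (n + 1)) (Fin (n + 1)) K) (p : MvPolynomial (Fin (n + 1)) K) :
    linearHom A p = MvPolynomial.aeval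
      (fun i => ∑ j, MvPolynomial.C (A i j) * MvPolynomial.X j) p := rfl

theorem linearHom_linearHom {n : ℕ} {K : Type u} [Field K]
    (A B : Matrix (Fin (n + 1)) (Fin (n + 1)) K) (p : MvPolynomial (Fin (n + 1)) K) :
    linearHom A (linearHom B p) = linearHom (B * A) p := by
  simp only [linearHom_apply]
  rw [← AlgHom.comp_apply]
  congr 1
  ext1 i
  simp only [AlgHom.comp_apply, MvPolynomial.aeval_X, map_sum, map_mul,
    MvPolynomial.algHom_C, MvPolynomial.algebraMap_eq, Matrix.mul_apply, Finset.mul_sum,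
    Finset.sum_mul]
  rw [Finset.sum_comm]
  simp only [mul_assoc]

theorem linearHom_one {n : ℕ} {K : Type u} [Field K] (p : MvPolynomial (Fin (n + 1)) K) :
    linearHom (1 : Matrix (Fin (n + 1)) (Fin (n + 1)) K) p = p := by
  rw [linearHom_apply]
  have : (fun i => ∑ j, MvPolynomial.C ((1 : Matrix (Fin (n + 1)) (Fin (n + 1)) K) i j) *
      MvPolynomial.X j : Fin (n + 1) → MvPolynomial (Fin (n + 1)) K) = MvPolynomial.X := by
    funext i
    simp [Matrix.one_apply, apply_ite MvPolynomial.C, ite_mul]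
  rw [this, MvPolynomial.aeval_X_left_apply]

/-- The automorphism `[A]` of `ℙ²_K` defined by `A ∈ GL₃(K)`. On points it is `x ↦ A x`, so the
`i`-th coordinate pulls back to `∑ⱼ Aᵢⱼ xⱼ`. -/
def linearMap {K : Type u} [Field K] (A : GL (Fin 3) K) :
    (projectivePlane K).left ⟶ (projectivePlane K).left :=
  Proj.map (linearHom (n := 2) (A : Matrix (Fin 3) (Fin 3) K))
    (irrelevant_le_map _ (linearHom (n := 2) ((A⁻¹ : GL (Fin 3) K) : Matrix (Fin 3) (Fin 3) K))
      fun x => by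
        rw [linearHom_linearHom, ← Units.val_mul, inv_mul_cancel, Units.val_one, linearHom_one])

/-- The action of a field automorphism `g` of `K` on the scheme `ℙ²_K`. It is
`[x₀ : x₁ : x₂] ↦ [g x₀ : g x₁ : g x₂]` on `K`-points; as a morphism of schemes it lies over
`Spec (g⁻¹)`, so it comes from `g⁻¹` on the coefficients of polynomials. -/
def galoisPlane {K : Type u} [Field K] (g : K ≃+* K) :
    (projectivePlane K).left ⟶ (projectivePlane K).left :=
  Proj.map (coeffHom 2 g.symm) (irrelevant_le_map _ (coeffHom 2 g) (coeffHom_symm 2 g.symm))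

/-! ### Schemes over `k`, base change and Galois action -/

/-- The base change functor `S ↦ S_L = S ×_k Spec L`. -/
abbrev baseChange (k : Type u) [Field k] (L : Type u) [Field L] [Algebra k L] :
    Over (Spec (CommRingCat.of k)) ⥤ Over (Spec (CommRingCat.of L)) :=
  Over.pullback (Spec.map (CommRingCat.ofHom (algebraMap k L)))

variable {k : Type u} [Field k]

/-- The action `id × Spec (g⁻¹)` of `g ∈ Gal(L/k)` on the scheme `S_L = S ×_k Spec L`. -/
def galoisBaseChange (S : Over (Spec (CommRingCat.of k))) {L : Type u} [Field L] [Algebra k L]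
    (g : L ≃ₐ[k] L) : ((baseChange k L).obj S).left ⟶ ((baseChange k L).obj S).left :=
  Limits.pullback.lift (Limits.pullback.fst _ _)
    (Limits.pullback.snd _ _ ≫ Spec.map (CommRingCat.ofHom (g.symm : L →+* L))) (by
      rw [Limits.pullback.condition, Category.assoc, ← Spec.map_comp, ← CommRingCat.ofHom_comp]
      congr 3
      ext x
      simp)

/-- A Severi-Brauer surface over `k`: a smooth projective surface which becomes isomorphic to
the projective plane over the algebraic closure of `k`. -/
structure IsSeveriBrauerSurface (S : Over (Spec (CommRingCat.of k))) : Prop where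
  smooth : SmoothOfRelativeDimension 2 S.hom
  projective : ∃ (n : ℕ) (i : S ⟶ projectiveSpace n k), IsClosedImmersion i.left
  geometricallyPlane :
    Nonempty ((baseChange k (AlgebraicClosure k)).obj S ≅ projectivePlane (AlgebraicClosure k))

/-! ### Representing automorphisms by matrices over a splitting field -/

section Representation

variable {S : Over (Spec (CommRingCat.of k))} {L : Type u} [Field L] [Algebra k L]

/-- The matrices `B g` represent the automorphisms of `ℙ²_L` given by the isomorphism
`φ : S_L ≅ ℙ²_L`, that is `φ ∘ g ∘ φ⁻¹ = [B g] ∘ g` for all `g ∈ Gal(L/k)`. -/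
def RepresentsGalois (φ : (baseChange k L).obj S ≅ projectivePlane L)
    (B : (L ≃ₐ[k] L) → GL (Fin 3) L) : Prop :=
  ∀ g : L ≃ₐ[k] L, φ.inv.left ≫ galoisBaseChange S g ≫ φ.hom.left =
    galoisPlane (g : L ≃+* L) ≫ linearMap (B g)

/-- The matrix `A` represents the automorphism `φ ∘ α_L ∘ φ⁻¹` of `ℙ²_L`. -/
def Represents (φ : (baseChange k L).obj S ≅ projectivePlane L) (α : Aut S)
    (A : GL (Fin 3) L) : Prop :=
  φ.inv.left ≫ ((baseChange k L).map α.hom).left ≫ φ.hom.left = linearMap A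

/-- The matrix `A` is an affine representant of `α`, relative to `φ` and the matrices `B g`: it
represents `φ ∘ α_L ∘ φ⁻¹`, and `A^g = (B g)⁻¹ A (B g)` for all `g ∈ Gal(L/k)`, where `A^g` is
obtained by applying `g` to all entries of `A`. -/
def IsAffineRepresentant (φ : (baseChange k L).obj S ≅ projectivePlane L)
    (B : (L ≃ₐ[k] L) → GL (Fin 3) L) (α : Aut S) (A : GL (Fin 3) L) : Prop :=
  Represents φ α A ∧
    ∀ g : L ≃ₐ[k] L, Matrix.GeneralLinearGroup.map (g : L →+* L) A = (B g)⁻¹ * A * B g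

end Representation

/-- The group `k* / (k*)³`. -/
abbrev UnitsModCubes (k : Type u) [Field k] : Type u :=
  kˣ ⧸ (powMonoidHom 3 : kˣ →* kˣ).range

end SeveriBrauer

end

namespace SeveriBrauer

/-! ### Homogeneous polynomials -/

section HomogeneousPolynomials

open MvPolynomial

variable {n : ℕ} {K : Type u} [Field K]

/-! Over a splitting field L the statement is linear algebra. Every L-automorphism of ℙ²_L is some
[A], with A unique up to L* (`exists_eq_linearMap`, `linearMap_eq_linearMap_iff`), so there are
matrices B_g for the Galois action and A for α_L. Since α is defined over k, α_L commutes with the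
Galois action, and A B_g = c_g B_g A^g for scalars c_g. These form a 1-cocycle, so c_g = g(x)/x by
Hilbert 90, and xA is an affine representant (`exists_isAffineRepresentant`). The remaining freedom
is a Galois-invariant scalar c in k*, which changes the determinant by c³; the determinant is itself
invariant because A^g is conjugate to A. Another φ conjugates A by the matrix of φ'φ⁻¹
(`IsAffineRepresentant.exists_det_eq`). Two splitting fields are compared inside the algebraic
closure, which is Galois over the perfect field k (`mk_det_eq_mk_det`).

Linearity of automorphisms is proved with curves and charts. An automorphism permutes the generic
points of integral curves, so the complement of a curve pulls back to the complement of a curve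
(`IsHomogeneousPrime.exists_preimage_basicOpen_eq`). Comparing functions that vanish on such curves
shows that H'/H^e', with H a linear form, pulls back to a constant times F'/F^m
(`IsHomogeneousPrime.mk_eq_of_preimage`). By degrees, lines pull back to lines, and X_i/X_0 becomes
a quotient of linear forms, whose coefficients are the matrix.

For a finite splitting field, the plane over the algebraic closure is the limit of the planes over
the finite Galois F/k (`isLimitPlaneCone`). As S is locally of finite presentation, the map from
this limit to S factors through some ℙ²_F. The induced ℙ²_F → S_F is an isomorphism over the
algebraic closure, hence an isomorphism by faithfully flat descent (`isIso_of_isIso_baseChange`). -/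

theorem eq_span_of_isPrime_le_span_of_ne_bot {R : Type*} [CommRing R] [IsDomain R]
    [WfDvdMonoid R] {F : R} (hF : Prime F) {p : Ideal R} (hp : p.IsPrime) (hp0 : p ≠ ⊥)
    (h : p ≤ Ideal.span {F}) : p = Ideal.span {F} := by
  refine le_antisymm h ?_
  obtain ⟨G, hG, hG0⟩ := Submodule.exists_mem_ne_zero_of_ne_bot hp0
  -- Split off all factors F from a nonzero element of p. By primality p contains F or the cofactor
  -- H, and H ∈ p ≤ (F) contradicts F ∤ H.
  obtain ⟨m, H, hH, rfl⟩ := WfDvdMonoid.max_power_factor hG0 hF.irreducible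
  rcases hp.mem_or_mem hG with h' | h'
  · rw [Ideal.span_singleton_le_iff_mem]
    exact hp.mem_of_pow_mem _ h'
  · exact absurd (Ideal.mem_span_singleton.1 (h h')) hH

/-- The homogeneous prime elements of degree `d`. -/
structure IsHomogeneousPrime (F : MvPolynomial (Fin (n + 1)) K) (d : ℕ) : Prop where
  homogeneous : F ∈ grading n K d
  prime : Prime F

theorem IsHomogeneousPrime.pos {F : MvPolynomial (Fin (n + 1)) K} {d : ℕ}
    (hF : IsHomogeneousPrime F d) : 0 < d := by
  rw [Nat.pos_iff_ne_zero]
  rintro rfl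
  have h := totalDegree_eq_zero_iff_eq_C.1 ((totalDegree_zero_iff_isHomogeneous _).2 hF.homogeneous)
  refine hF.prime.not_isUnit (h ▸ ?_)
  refine IsUnit.map C (isUnit_iff_ne_zero.2 fun h0 => hF.prime.ne_zero ?_)
  rw [h, h0, C_0]

theorem isHomogeneousPrime_X (i : Fin (n + 1)) :
    IsHomogeneousPrime (X i : MvPolynomial (Fin (n + 1)) K) 1 :=
  ⟨isHomogeneous_X _ _, X_prime⟩

/-- Multiplication by F shifts degrees by d, so the cofactor can be replaced by its component of
degree e - d. -/
theorem exists_isHomogeneous_of_dvd {F G : MvPolynomial (Fin (n + 1)) K} {d e : ℕ}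
    (hF : F ∈ grading n K d) (hG : G ∈ grading n K e) (hG0 : G ≠ 0) (h : F ∣ G) :
    ∃ H m, H ∈ grading n K m ∧ G = F * H ∧ e = d + m := by
  obtain ⟨H, rfl⟩ := h
  have h0 : ((DirectSum.decompose (grading n K) (F * H)) e : MvPolynomial (Fin (n + 1)) K) ≠ 0 := by
    rwa [DirectSum.decompose_of_mem_same _ hG]
  have hde : d ≤ e := by
    by_contra hde
    exact h0 (DirectSum.coe_decompose_mul_of_left_mem_of_not_le (grading n K) hF hde)
  refine ⟨DirectSum.decompose (grading n K) H (e - d), e - d, Subtype.property _, ?_, by omega⟩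
  rw [← DirectSum.coe_decompose_mul_of_left_mem_of_le (grading n K) hF hde,
    DirectSum.decompose_of_mem_same _ hG]

/-- A homogeneous ideal contains the top component of F. This is a multiple of F of the same total
degree, so the quotient is a nonzero constant. -/
theorem exists_isHomogeneousPrime_of_span_isHomogeneous {F : MvPolynomial (Fin (n + 1)) K}
    (hF : Prime F) (h : (Ideal.span {F}).IsHomogeneous (grading n K)) :
    ∃ d, IsHomogeneousPrime F d := by
  refine ⟨F.totalDegree, ?_, hF⟩
  set d := F.totalDegree with hd
  have h1 : homogeneousComponent d F ∈ Ideal.span {F} := by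
    have := h d (Ideal.mem_span_singleton_self F)
    rwa [show (DirectSum.decompose (grading n K) F d : MvPolynomial (Fin (n + 1)) K) =
      homogeneousComponent d F from MvPolynomial.decomposition.decompose'_apply F d] at this
  have h0 : homogeneousComponent d F ≠ 0 := by
    obtain ⟨m, hm, hmd⟩ := F.support.exists_mem_eq_sup (by simpa using hF.ne_zero)
      (fun s => s.sum fun _ e => e)
    intro h0
    have h2 := congrArg (coeff m) h0
    rw [coeff_homogeneousComponent, if_pos] at h2
    · exact (mem_support_iff.1 hm) (by simpa using h2)
    · rw [hd, totalDegree, hmd]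
      simp [Finsupp.degree_apply, Finsupp.sum]
  obtain ⟨c, hc⟩ := Ideal.mem_span_singleton.1 h1
  have hc0 : c ≠ 0 := by rintro rfl; exact h0 (by simpa using hc)
  have h2 := (homogeneousComponent_isHomogeneous d F).totalDegree h0
  rw [hc, totalDegree_mul_of_isDomain hF.ne_zero hc0, ← hd] at h2
  have h3 := totalDegree_eq_zero_iff_eq_C.1 (by omega : c.totalDegree = 0)
  have hc0' : coeff 0 c ≠ 0 := by
    intro h4; rw [h4, C_0] at h3; exact hc0 h3
  have h4 : F = C (coeff 0 c)⁻¹ * homogeneousComponent d F := by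
    rw [hc, mul_comm F c, ← mul_assoc]
    nth_rw 2 [h3]
    rw [← C_mul, inv_mul_cancel₀ hc0', C_1, one_mul]
  rw [h4]
  exact (homogeneousComponent_isHomogeneous d F).C_mul _

/-- Some prime factor F of a nonzero homogeneous G ∈ q lies in q. The homogeneous core of (F) is
prime and contains G, so it is a nonzero prime inside (F) and must be (F). Hence (F) is homogeneous,
and so is F. -/
theorem exists_isHomogeneousPrime_mem {q : Ideal (MvPolynomial (Fin (n + 1)) K)}
    (hq : q.IsPrime) (hq' : q.IsHomogeneous (grading n K)) (hq0 : q ≠ ⊥) :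
    ∃ F d, IsHomogeneousPrime F d ∧ F ∈ q := by
  classical
  obtain ⟨G, hG, hG0⟩ := Submodule.exists_mem_ne_zero_of_ne_bot hq0
  obtain ⟨e, G, hGe, hGq, hG0⟩ : ∃ e, ∃ G ∈ grading n K e, G ∈ q ∧ G ≠ 0 := by
    by_contra! h
    refine hG0 ?_
    rw [← DirectSum.sum_support_decompose (grading n K) G]
    exact Finset.sum_eq_zero fun i _ => h i _ (Subtype.property _) (hq' i hG)
  obtain ⟨f, hf, u, hu⟩ := UniqueFactorizationMonoid.exists_prime_factors G hG0
  obtain ⟨F, hFf, hFq⟩ := (hq.multiset_prod_mem_iff_exists_mem f).1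
    ((Ideal.mul_unit_mem_iff_mem q u.isUnit).1 (hu ▸ hGq))
  have hF := hf F hFf
  have hFG : G ∈ Ideal.span {F} :=
    Ideal.mem_span_singleton.2 ((Multiset.dvd_prod hFf).trans (Dvd.intro _ hu))
  have hFp : (Ideal.span {F}).IsPrime := (Ideal.span_singleton_prime hF.ne_zero).2 hF
  have hcore := eq_span_of_isPrime_le_span_of_ne_bot hF (hFp.homogeneousCore (𝒜 := grading n K))
    (fun h => hG0 ?_) (Ideal.toIdeal_homogeneousCore_le _ _)
  · obtain ⟨d, hd⟩ := exists_isHomogeneousPrime_of_span_isHomogeneous hF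
      (hcore ▸ HomogeneousIdeal.isHomogeneous _)
    exact ⟨F, d, hd, hFq⟩
  · have := Ideal.mem_homogeneousCore_of_homogeneous_of_mem (𝒜 := grading n K) ⟨e, hGe⟩ hFG
    change G ∈ (Ideal.homogeneousCore (grading n K) (Ideal.span {F})).toIdeal at this
    rwa [h] at this

end HomogeneousPolynomials

/-! ### Points of the projective plane -/

section Points

open MvPolynomial

variable {K : Type u} [Field K]

/-- The point of `ℙ²` defined by a prime ideal which does not contain all coordinates: its ideal
is generated by the homogeneous elements of the given prime. -/
noncomputable def corePoint (p : Ideal (MvPolynomial (Fin 3) K)) (hp : p.IsPrime) (h : ∃ i, X i ∉ p) :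
    Proj (grading 2 K) where
  asHomogeneousIdeal := p.homogeneousCore (grading 2 K)
  isPrime := hp.homogeneousCore
  not_irrelevant_le := fun hle => by
    obtain ⟨i, hi⟩ := h
    exact hi (Ideal.toIdeal_homogeneousCore_le _ _
      (hle (HomogeneousIdeal.mem_irrelevant_of_mem (grading 2 K) Nat.one_pos
        (isHomogeneous_X K i))))

theorem mem_corePoint {p : Ideal (MvPolynomial (Fin 3) K)} (hp : p.IsPrime) (h : ∃ i, X i ∉ p)
    {G : MvPolynomial (Fin 3) K} {e : ℕ} (hG : G ∈ grading 2 K e) :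
    G ∈ (corePoint p hp h).asHomogeneousIdeal ↔ G ∈ p :=
  ⟨fun hG' => Ideal.toIdeal_homogeneousCore_le _ _ hG',
    fun hG' => Ideal.mem_homogeneousCore_of_homogeneous_of_mem ⟨e, hG⟩ hG'⟩

/-- The generic point of `ℙ²`. -/
noncomputable def genericPt (K : Type u) [Field K] : Proj (grading 2 K) :=
  corePoint ⊥ Ideal.isPrime_bot ⟨0, by simp [X_ne_zero]⟩

theorem genericPt_asHomogeneousIdeal :
    (genericPt K).asHomogeneousIdeal.toIdeal = ⊥ :=
  le_bot_iff.1 (Ideal.toIdeal_homogeneousCore_le _ _)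

theorem genericPt_mem_basicOpen {G : MvPolynomial (Fin 3) K} (h : G ≠ 0) :
    genericPt K ∈ Proj.basicOpen (grading 2 K) G := by
  intro h'
  change G ∈ (genericPt K).asHomogeneousIdeal.toIdeal at h'
  rw [genericPt_asHomogeneousIdeal] at h'
  exact h h'

theorem IsHomogeneousPrime.dvd_of_dvd_X {F : MvPolynomial (Fin 3) K} {d : ℕ}
    (hF : IsHomogeneousPrime (n := 2) F d) {i j : Fin 3} (h : F ∣ X i) (h' : F ∣ X j) : i = j := by
  have h1 := (hF.prime.irreducible.associated_of_dvd (X_prime (i := i)).irreducible h).symm.dvd.trans h'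
  by_contra hij
  obtain ⟨c, hc⟩ := h1
  have := congrArg (eval (Pi.single j (1 : K))) hc
  simp [hij] at this

theorem IsHomogeneousPrime.exists_X_notMem {F : MvPolynomial (Fin 3) K} {d : ℕ}
    (hF : IsHomogeneousPrime (n := 2) F d) : ∃ i : Fin 3, X i ∉ Ideal.span {F} := by
  by_contra! h
  exact absurd (hF.dvd_of_dvd_X (Ideal.mem_span_singleton.1 (h 0))
    (Ideal.mem_span_singleton.1 (h 1))) (by decide)

/-- The generic point of the curve `F = 0`. -/
noncomputable def IsHomogeneousPrime.point {F : MvPolynomial (Fin 3) K} {d : ℕ}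
    (hF : IsHomogeneousPrime (n := 2) F d) : Proj (grading 2 K) :=
  corePoint (Ideal.span {F}) ((Ideal.span_singleton_prime hF.prime.ne_zero).2 hF.prime)
    hF.exists_X_notMem

theorem IsHomogeneousPrime.mem_point {F : MvPolynomial (Fin 3) K} {d : ℕ}
    (hF : IsHomogeneousPrime (n := 2) F d) {G : MvPolynomial (Fin 3) K} {e : ℕ}
    (hG : G ∈ grading 2 K e) : G ∈ hF.point.asHomogeneousIdeal ↔ F ∣ G := by
  rw [IsHomogeneousPrime.point, mem_corePoint _ _ hG, Ideal.mem_span_singleton]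

theorem IsHomogeneousPrime.point_asHomogeneousIdeal {F : MvPolynomial (Fin 3) K} {d : ℕ}
    (hF : IsHomogeneousPrime (n := 2) F d) :
    hF.point.asHomogeneousIdeal.toIdeal = Ideal.span {F} :=
  le_antisymm (Ideal.toIdeal_homogeneousCore_le _ _)
    ((Ideal.span_singleton_le_iff_mem _).2 ((hF.mem_point hF.homogeneous).2 dvd_rfl))

/-- Test the inclusion at the generic point of the curve F = 0. This is how information about open
sets is turned back into divisibility. -/
theorem IsHomogeneousPrime.dvd_of_basicOpen_le {F G H : MvPolynomial (Fin 3) K} {d e : ℕ}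
    (hF : IsHomogeneousPrime (n := 2) F d) (hG : G ∈ grading 2 K e)
    (h : Proj.basicOpen (grading 2 K) G ≤ Proj.basicOpen (grading 2 K) H) (hFH : F ∣ H) :
    F ∣ G := by
  by_contra hFG
  have h1 : hF.point ∈ Proj.basicOpen (grading 2 K) G := fun h1 => hFG ((hF.mem_point hG).1 h1)
  refine h h1 (Ideal.mem_of_dvd _ hFH ?_)
  exact (hF.mem_point hF.homogeneous).2 dvd_rfl

theorem specializes_iff {x y : Proj (grading 2 K)} :
    x ⤳ y ↔ x.asHomogeneousIdeal.toIdeal ≤ y.asHomogeneousIdeal.toIdeal := by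
  rw [specializes_iff_mem_closure]
  exact (ProjectiveSpectrum.le_iff_mem_closure (𝒜 := grading 2 K) x y).symm

theorem genericPt_specializes (y : Proj (grading 2 K)) : genericPt K ⤳ y := by
  rw [specializes_iff, genericPt_asHomogeneousIdeal]
  exact bot_le

/-- The complement of a curve is expressed by specialization alone, so that homeomorphisms transport
it. -/
theorem IsHomogeneousPrime.mem_basicOpen_iff {F : MvPolynomial (Fin 3) K} {d : ℕ}
    (hF : IsHomogeneousPrime (n := 2) F d) (x : Proj (grading 2 K)) :
    x ∈ Proj.basicOpen (grading 2 K) F ↔ ¬ hF.point ⤳ x := by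
  rw [specializes_iff, hF.point_asHomogeneousIdeal, Ideal.span_singleton_le_iff_mem]
  rfl

theorem ext_of_asHomogeneousIdeal {x y : Proj (grading 2 K)}
    (h : x.asHomogeneousIdeal.toIdeal = y.asHomogeneousIdeal.toIdeal) : x = y :=
  ProjectiveSpectrum.ext (HomogeneousIdeal.toIdeal_injective h)

/-- An automorphism of `ℙ²` maps integral curves to integral curves. -/
theorem IsHomogeneousPrime.exists_preimage_basicOpen_eq {H : MvPolynomial (Fin 3) K} {e : ℕ}
    (hH : IsHomogeneousPrime (n := 2) H e) (f : Proj (grading 2 K) ⟶ Proj (grading 2 K))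
    [IsIso f] : ∃ F d, IsHomogeneousPrime (n := 2) F d ∧
      f ⁻¹ᵁ Proj.basicOpen (grading 2 K) H = Proj.basicOpen (grading 2 K) F := by
  have hspec : ∀ x y, f x ⤳ f y ↔ x ⤳ y := fun x y => f.homeomorph.isInducing.specializes_iff
  obtain ⟨ξ, hξ⟩ := f.surjective hH.point
  have hgen : ∀ y, f (genericPt K) ⤳ y := fun y => by
    obtain ⟨x, rfl⟩ := f.surjective y
    exact (hspec _ _).2 (genericPt_specializes x)
  -- Only the generic point specializes to every point.
  have hgen' : f (genericPt K) = genericPt K := by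
    refine ext_of_asHomogeneousIdeal (le_antisymm ?_ ?_)
    · exact specializes_iff.1 (hgen _)
    · exact specializes_iff.1 (genericPt_specializes _)
  have hξ0 : ξ.asHomogeneousIdeal.toIdeal ≠ ⊥ := by
    intro h0
    obtain rfl : ξ = genericPt K :=
      ext_of_asHomogeneousIdeal (h0.trans genericPt_asHomogeneousIdeal.symm)
    rw [hgen'] at hξ
    exact (hH.mem_basicOpen_iff _).1 (genericPt_mem_basicOpen hH.prime.ne_zero)
      (hξ ▸ specializes_rfl)
  -- Choose a curve F = 0 through ξ. Its generic point specializes to ξ, so the image of that point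
  -- is a nonzero prime inside (H), hence equal to (H).
  obtain ⟨F, d, hF, hFξ⟩ := exists_isHomogeneousPrime_mem ξ.isPrime
    ξ.asHomogeneousIdeal.isHomogeneous hξ0
  have h1 : hF.point ⤳ ξ := by
    rwa [specializes_iff, hF.point_asHomogeneousIdeal, Ideal.span_singleton_le_iff_mem]
  have h2 : f hF.point = hH.point := by
    refine ext_of_asHomogeneousIdeal ?_
    rw [hH.point_asHomogeneousIdeal]
    refine eq_span_of_isPrime_le_span_of_ne_bot hH.prime (f hF.point).isPrime (fun h0 => ?_) ?_
    · have : f hF.point = f (genericPt K) := by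
        rw [hgen']
        exact ext_of_asHomogeneousIdeal (h0.trans genericPt_asHomogeneousIdeal.symm)
      have h3 : hF.point ⤳ genericPt K := (hspec _ _).1 (this ▸ specializes_rfl)
      exact (hF.mem_basicOpen_iff _).1 (genericPt_mem_basicOpen hF.prime.ne_zero) h3
    · rw [← hH.point_asHomogeneousIdeal, ← specializes_iff, ← hξ]
      exact (hspec _ _).2 h1
  refine ⟨F, d, hF, ?_⟩
  ext x
  change f x ∈ Proj.basicOpen (grading 2 K) H ↔ x ∈ Proj.basicOpen (grading 2 K) F
  rw [hH.mem_basicOpen_iff, hF.mem_basicOpen_iff, ← h2, hspec]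

end Points

/-! ### Affine charts of the projective plane -/

section Charts

open MvPolynomial HomogeneousLocalization

variable {K : Type u} [Field K]

theorem away_mk_eq_mk_iff {F : MvPolynomial (Fin 3) K} {d : ℕ} (hF : F ∈ grading 2 K d)
    (hF0 : F ≠ 0) {n m : ℕ} {x y : MvPolynomial (Fin 3) K} (hx : x ∈ grading 2 K (n • d))
    (hy : y ∈ grading 2 K (m • d)) :
    Away.mk (grading 2 K) hF n x hx = Away.mk (grading 2 K) hF m y hy ↔
      x * F ^ m = y * F ^ n := by
  rw [HomogeneousLocalization.ext_iff_val, Away.val_mk, Away.val_mk, Localization.mk_eq_mk_iff,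
    Localization.r_iff_exists]
  constructor
  · rintro ⟨⟨_, k, rfl⟩, hc⟩
    have := mul_left_cancel₀ (pow_ne_zero k hF0) hc
    simpa [mul_comm] using this
  · intro h
    exact ⟨1, by simpa [mul_comm] using h⟩

theorem away_mk_eq_zero_iff {F : MvPolynomial (Fin 3) K} {d : ℕ} (hF : F ∈ grading 2 K d)
    (hF0 : F ≠ 0) {n : ℕ} {x : MvPolynomial (Fin 3) K} (hx : x ∈ grading 2 K (n • d)) :
    Away.mk (grading 2 K) hF n x hx = 0 ↔ x = 0 := by
  rw [HomogeneousLocalization.ext_iff_val, Away.val_mk, val_zero, Localization.mk_eq_mk'_apply,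
    IsLocalization.mk'_eq_zero_iff]
  constructor
  · rintro ⟨⟨_, k, rfl⟩, hk⟩
    exact (mul_eq_zero.1 hk).resolve_left (pow_ne_zero k hF0)
  · rintro rfl
    exact ⟨1, by simp⟩

theorem away_mk_mul_mk {F : MvPolynomial (Fin 3) K} {d : ℕ} (hF : F ∈ grading 2 K d)
    {n m : ℕ} {x y : MvPolynomial (Fin 3) K} (hx : x ∈ grading 2 K (n • d))
    (hy : y ∈ grading 2 K (m • d)) :
    Away.mk (grading 2 K) hF n x hx * Away.mk (grading 2 K) hF m y hy =
      Away.mk (grading 2 K) hF (n + m) (x * y) (by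
        rw [add_smul]; exact SetLike.mul_mem_graded hx hy) := by
  rw [HomogeneousLocalization.ext_iff_val, val_mul, Away.val_mk, Away.val_mk, Away.val_mk,
    Localization.mk_mul]
  congr 1
  ext
  simp [pow_add]

theorem X_mem_grading (K : Type u) [Field K] (i : Fin 3) :
    (X i : MvPolynomial (Fin 3) K) ∈ grading 2 K 1 :=
  isHomogeneous_X K i

/-- The constants in a chart. -/
noncomputable def awayC (F : MvPolynomial (Fin 3) K) : K →+* Away (grading 2 K) F :=
  (fromZeroRingHom (grading 2 K) _).comp (algebraMap K (grading 2 K 0))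

theorem awayC_val (F : MvPolynomial (Fin 3) K) (c : K) :
    (awayC F c).val = algebraMap _ _ (C c : MvPolynomial (Fin 3) K) := by
  rw [← Localization.mk_one_eq_algebraMap]
  rfl

theorem awayC_eq_mk {F : MvPolynomial (Fin 3) K} {d : ℕ} (hF : F ∈ grading 2 K d) (c : K) :
    awayC F c = Away.mk (grading 2 K) hF 0 (C c) (by simp) := by
  rw [HomogeneousLocalization.ext_iff_val, awayC_val, Away.val_mk,
    ← Localization.mk_one_eq_algebraMap]
  congr 1

/-- The affine coordinates `Xᵢ / Xⱼ` of the chart `Xⱼ ≠ 0`. -/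
noncomputable def awayX (j i : Fin 3) : Away (grading 2 K) (X j : MvPolynomial (Fin 3) K) :=
  Away.mk (grading 2 K) (d := 1) (X_mem_grading K j) 1 (X i) (by simpa using X_mem_grading K i)

theorem eval₂_smul_of_isHomogeneous {R S σ : Type*} [CommSemiring R] [CommSemiring S]
    (f : R →+* S) (r : S) (g : σ → S) {G : MvPolynomial σ R} {m : ℕ} (hG : G.IsHomogeneous m) :
    eval₂ f (fun i => r * g i) G = r ^ m * eval₂ f g G := by
  rw [eval₂_eq, eval₂_eq, Finset.mul_sum]
  refine Finset.sum_congr rfl fun s hs => ?_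
  simp only [mul_pow, Finset.prod_mul_distrib, Finset.prod_pow_eq_pow_sum]
  rw [← hG.degree_eq_sum_deg_support hs]
  ring

/-- Dehomogenization. In the full localization, multiplying by X_j^m turns each X_i/X_j back into
X_i, by homogeneity. -/
theorem away_mk_X_eq_eval₂ (j : Fin 3) {m : ℕ} {G : MvPolynomial (Fin 3) K}
    (hG : G ∈ grading 2 K (m • 1)) :
    Away.mk (grading 2 K) (d := 1) (X_mem_grading K j) m G hG =
      eval₂ (awayC (X j)) (awayX j) G := by
  have hG' : G.IsHomogeneous m := by simpa using hG
  let φ := algebraMap (Away (grading 2 K) (X j : MvPolynomial (Fin 3) K))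
    (Localization.Away (X j : MvPolynomial (Fin 3) K))
  let ι := algebraMap (MvPolynomial (Fin 3) K) (Localization.Away (X j : MvPolynomial (Fin 3) K))
  have hu : IsUnit (ι (X j)) := IsLocalization.Away.algebraMap_isUnit _
  have hφ : ∀ y, y.val = φ y := fun y => (HomogeneousLocalization.algebraMap_apply y).symm
  apply HomogeneousLocalization.val_injective
  rw [hφ, hφ]
  refine (hu.pow m).mul_left_cancel ?_
  rw [hom_eval₂]
  have h1 : φ.comp (awayC (X j)) = ι.comp C := by
    ext c
    exact awayC_val _ _
  rw [h1, ← eval₂_smul_of_isHomogeneous _ _ _ hG']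
  have h2 : (fun i => ι (X j) * φ (awayX j i)) = fun i => ι (X i) := by
    funext i
    simp only [← hφ, ι, awayX, Away.val_mk, pow_one,
      Localization.mk_eq_mk'_apply, IsLocalization.mk'_spec'_mk]
  rw [h2]
  have h3 : eval₂ (ι.comp C) (fun i => ι (X i)) G = ι G := by
    rw [← hom_eval₂ G C ι X, eval₂_eta]
  rw [h3]
  simp only [← hφ, ι, Away.val_mk]
  rw [← map_pow, Localization.mk_eq_mk'_apply, IsLocalization.mk'_spec'_mk]

theorem away_X_hom_ext {T : Type*} [CommRing T] (j : Fin 3)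
    {a b : Away (grading 2 K) (X j : MvPolynomial (Fin 3) K) →+* T}
    (hC : ∀ c, a (awayC (X j) c) = b (awayC (X j) c))
    (hX : ∀ i, a (awayX j i) = b (awayX j i)) : a = b := by
  ext x
  obtain ⟨m, G, hG, rfl⟩ := Away.mk_surjective (grading 2 K) (X_mem_grading K j) x
  rw [away_mk_X_eq_eval₂, hom_eval₂, hom_eval₂, show a.comp _ = b.comp _ from RingHom.ext hC,
    show (fun i => a (awayX j i)) = _ from funext hX]

/-- The structure morphism of `ℙ²`. -/
noncomputable def planeHom (K : Type u) [Field K] :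
    Proj (grading 2 K) ⟶ Spec (CommRingCat.of K) :=
  Proj.toSpecZero (grading 2 K) ≫ Spec.map (CommRingCat.ofHom (algebraMap K (grading 2 K 0)))

theorem awayι_planeHom {F : MvPolynomial (Fin 3) K} {d : ℕ} (hF : F ∈ grading 2 K d)
    (hd : 0 < d) : Proj.awayι (grading 2 K) F hF hd ≫ planeHom K =
      Spec.map (CommRingCat.ofHom (awayC F)) := by
  rw [planeHom, Proj.awayι_toSpecZero_assoc, ← Spec.map_comp]
  rfl

/-- The map between charts induced by an automorphism of `ℙ²`. -/
theorem exists_away_ringEquiv (f : Proj (grading 2 K) ⟶ Proj (grading 2 K)) [IsIso f]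
    {F H : MvPolynomial (Fin 3) K} {d e : ℕ} (hF : F ∈ grading 2 K d) (hH : H ∈ grading 2 K e)
    (hd : 0 < d) (he : 0 < e)
    (h : f ⁻¹ᵁ Proj.basicOpen (grading 2 K) H = Proj.basicOpen (grading 2 K) F) :
    ∃ θ : Away (grading 2 K) H ≃+* Away (grading 2 K) F,
      Spec.map (CommRingCat.ofHom (θ : _ →+* _)) ≫ Proj.awayι (grading 2 K) H hH he =
        Proj.awayι (grading 2 K) F hF hd ≫ f := by
  have hr : (Proj.awayι (grading 2 K) F hF hd ≫ f).opensRange =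
      (Proj.awayι (grading 2 K) H hH he).opensRange := by
    rw [Proj.opensRange_awayι, Scheme.Hom.opensRange_comp, Proj.opensRange_awayι, ← h]
    ext x
    obtain ⟨x, rfl⟩ := f.surjective x
    exact ⟨fun ⟨y, hy, hyx⟩ => hyx ▸ hy, fun hx => ⟨x, hx, rfl⟩⟩
  let i := IsOpenImmersion.isoOfRangeEq (Proj.awayι (grading 2 K) F hF hd ≫ f)
    (Proj.awayι (grading 2 K) H hH he) (congrArg TopologicalSpace.Opens.carrier hr)
  let θ := Spec.preimage i.hom
  have hb : Function.Bijective θ.hom := by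
    have : IsIso (Spec.map θ) := by
      rw [Spec.map_preimage]
      infer_instance
    exact isIso_SpecMap_iff.1 this
  refine ⟨RingEquiv.ofBijective θ.hom hb, ?_⟩
  have : Spec.map (CommRingCat.ofHom (RingEquiv.ofBijective θ.hom hb : _ →+* _)) = i.hom := by
    rw [← Spec.map_preimage i.hom]
    rfl
  rw [this]
  exact IsOpenImmersion.isoOfRangeEq_hom_fac _ _ _

/-- On the chart F ≠ 0 the function attached to FG is (FG)^d / F^((n+1)d) = (G/F^n)^d, and a power
has the same nonvanishing locus as its base. -/
theorem awayι_preimage_basicOpen_mul {F G : MvPolynomial (Fin 3) K} {d n : ℕ}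
    (hF : F ∈ grading 2 K d) (hd : 0 < d) (hG : G ∈ grading 2 K (n • d)) :
    Proj.awayι (grading 2 K) F hF hd ⁻¹ᵁ Proj.basicOpen (grading 2 K) (F * G) =
      PrimeSpectrum.basicOpen (Away.mk (grading 2 K) hF n G hG) := by
  have hFG : F * G ∈ grading 2 K ((n + 1) * d) := by
    have := SetLike.mul_mem_graded hF hG
    simpa [add_mul, add_comm] using this
  rw [Proj.awayι_preimage_basicOpen (grading 2 K) hF hd hFG (by positivity),
    ← PrimeSpectrum.basicOpen_pow (Away.mk (grading 2 K) hF n G hG) d hd]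
  congr 1
  rw [HomogeneousLocalization.ext_iff_val, val_pow, Away.val_mk, Away.val_mk,
    Localization.mk_pow, Localization.mk_eq_mk_iff, Localization.r_iff_exists]
  refine ⟨1, ?_⟩
  simp
  ring

/-- Turns an identity of fractions under θ into an identity of open sets. Both sides lie in the
chart F ≠ 0, so it is enough to compare them there. -/
theorem preimage_basicOpen_mul_eq {f : Proj (grading 2 K) ⟶ Proj (grading 2 K)}
    {F H : MvPolynomial (Fin 3) K} {d e : ℕ} {hF : F ∈ grading 2 K d} {hH : H ∈ grading 2 K e}
    {hd : 0 < d} {he : 0 < e}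
    (h : f ⁻¹ᵁ Proj.basicOpen (grading 2 K) H = Proj.basicOpen (grading 2 K) F)
    {θ : Away (grading 2 K) H →+* Away (grading 2 K) F}
    (hθ : Spec.map (CommRingCat.ofHom θ) ≫ Proj.awayι (grading 2 K) H hH he =
        Proj.awayι (grading 2 K) F hF hd ≫ f)
    {n m : ℕ} {U G : MvPolynomial (Fin 3) K} (hU : U ∈ grading 2 K (n • e))
    (hG : G ∈ grading 2 K (m • d))
    (hUG : θ (Away.mk (grading 2 K) hH n U hU) = Away.mk (grading 2 K) hF m G hG) :
    f ⁻¹ᵁ Proj.basicOpen (grading 2 K) (H * U) = Proj.basicOpen (grading 2 K) (F * G) := by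
  have h1 : Proj.awayι (grading 2 K) F hF hd ⁻¹ᵁ f ⁻¹ᵁ Proj.basicOpen (grading 2 K) (H * U) =
      Proj.awayι (grading 2 K) F hF hd ⁻¹ᵁ Proj.basicOpen (grading 2 K) (F * G) := by
    rw [← Scheme.Hom.comp_preimage, ← hθ, Scheme.Hom.comp_preimage,
      awayι_preimage_basicOpen_mul hH he hU, awayι_preimage_basicOpen_mul hF hd hG, ← hUG]
    rfl
  have h2 : f ⁻¹ᵁ Proj.basicOpen (grading 2 K) (H * U) ≤ Proj.basicOpen (grading 2 K) F := by
    rw [← h]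
    exact f.preimage_mono (Proj.basicOpen_mono _ _ _ (dvd_mul_right _ _))
  have h3 : Proj.basicOpen (grading 2 K) (F * G) ≤ Proj.basicOpen (grading 2 K) F :=
    Proj.basicOpen_mono _ _ _ (dvd_mul_right _ _)
  rw [← Proj.opensRange_awayι (grading 2 K) F hF hd] at h2 h3
  ext x
  constructor
  · intro hx
    obtain ⟨y, rfl⟩ := h2 hx
    exact h1.le hx
  · intro hx
    obtain ⟨y, rfl⟩ := h3 hx
    exact h1.ge hx

end Charts

/-! ### Automorphisms of the projective plane are linear -/

section Automorphisms

open MvPolynomial HomogeneousLocalization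

variable {K : Type u} [Field K]

/-- After all factors F are removed from G, an irreducible factor of the rest would divide both X 0
and X 1. -/
theorem IsHomogeneousPrime.exists_eq_C_mul_pow {F G : MvPolynomial (Fin 3) K} {d e M N : ℕ}
    (hF : IsHomogeneousPrime (n := 2) F d) (hG : G ∈ grading 2 K e) (hG0 : G ≠ 0)
    (h0 : G ∣ X 0 ^ M * F ^ N) (h1 : G ∣ X 1 ^ M * F ^ N) :
    ∃ (c : K) (a : ℕ), c ≠ 0 ∧ G = C c * F ^ a ∧ e = a * d := by
  obtain ⟨a, Q, hQ, rfl⟩ := WfDvdMonoid.max_power_factor hG0 hF.prime.irreducible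
  have hQu : IsUnit Q := by
    by_contra hQu
    obtain ⟨p, hp, hpQ⟩ := WfDvdMonoid.exists_irreducible_factor hQu (right_ne_zero_of_mul hG0)
    have hp' := hp.prime
    have hpF : ¬ p ∣ F := fun h =>
      hQ ((hp.associated_of_dvd hF.prime.irreducible h).symm.dvd.trans hpQ)
    have key : ∀ i : Fin 3, F ^ a * Q ∣ X i ^ M * F ^ N → p ∣ X i := fun i hi => by
      rcases hp'.dvd_or_dvd ((hpQ.trans (dvd_mul_left _ _)).trans hi) with h | h
      · exact hp'.dvd_of_dvd_pow h
      · exact absurd (hp'.dvd_of_dvd_pow h) hpF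
    have h2 := (hp.associated_of_dvd (X_prime (i := (0 : Fin 3))).irreducible (key 0 h0)).symm.dvd.trans
      (key 1 h1)
    obtain ⟨c, hc⟩ := h2
    have := congrArg (eval (Pi.single (1 : Fin 3) (1 : K))) hc
    simp at this
  obtain ⟨c, hc, hcQ⟩ := MvPolynomial.isUnit_iff_eq_C_of_isReduced.1 hQu
  refine ⟨c, a, hc.ne_zero, by rw [hcQ, mul_comm], ?_⟩
  have h2 : F ^ a * Q ∈ grading 2 K (a * d) := by
    rw [hcQ, mul_comm (F ^ a), mul_comm a d]
    exact (hF.homogeneous.pow a).C_mul c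
  exact IsHomogeneous.inj_right hG h2 hG0

/-- Comparing vanishing loci gives θ(H'/H^e') = F'G'/F^m. As H has degree 1, a function on its chart
that vanishes on H' = 0 is a multiple of H'/H^e'. Carried over by θ, this makes F'G'/F^m divide
fractions with numerator F' X_j^N, so G' divides a power of X_j times a power of F for every j.
Hence G' is a constant times a power of F, which cancels. The relation d ∣ d' obtained on the way is
what forces degree one later. -/
theorem IsHomogeneousPrime.mk_eq_of_preimage
    {f : Proj (grading 2 K) ⟶ Proj (grading 2 K)} [IsIso f]
    {F F' H H' : MvPolynomial (Fin 3) K} {d d' e' : ℕ}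
    (hF : IsHomogeneousPrime (n := 2) F d) (hF' : IsHomogeneousPrime (n := 2) F' d')
    (hH : IsHomogeneousPrime (n := 2) H 1) (hH' : IsHomogeneousPrime (n := 2) H' e')
    (h : f ⁻¹ᵁ Proj.basicOpen (grading 2 K) H = Proj.basicOpen (grading 2 K) F)
    (h' : f ⁻¹ᵁ Proj.basicOpen (grading 2 K) H' = Proj.basicOpen (grading 2 K) F')
    (hFF' : ¬ F ∣ F')
    {θ : Away (grading 2 K) H ≃+* Away (grading 2 K) F}
    (hθ : Spec.map (CommRingCat.ofHom (θ : _ →+* _)) ≫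
      Proj.awayι (grading 2 K) H hH.homogeneous hH.pos =
        Proj.awayι (grading 2 K) F hF.homogeneous hF.pos ≫ f) :
    ∃ (c : K) (m : ℕ) (hc : C c * F' ∈ grading 2 K (m • d)), c ≠ 0 ∧ d' = m * d ∧
      θ (Away.mk (grading 2 K) hH.homogeneous e' H' (by simpa using hH'.homogeneous)) =
        Away.mk (grading 2 K) hF.homogeneous m (C c * F') hc := by
  have hd := hF.pos
  have hH'e : H' ∈ grading 2 K (e' • 1) := by simpa using hH'.homogeneous
  -- opens of the target are determined by their preimages
  have hle : ∀ {U V : (Proj (grading 2 K)).Opens}, f ⁻¹ᵁ U ≤ f ⁻¹ᵁ V → U ≤ V := by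
    intro U V hUV y hy
    obtain ⟨x, rfl⟩ := f.surjective y
    exact hUV hy
  have hF'F : ¬ F' ∣ F := fun h2 =>
    hFF' (hF'.prime.irreducible.associated_of_dvd hF.prime.irreducible h2).symm.dvd
  have hHH' : ¬ H' ∣ H := fun h2 => hF'F <| by
    refine hF'.dvd_of_basicOpen_le (H := F') hF.homogeneous ?_ dvd_rfl
    rw [← h, ← h']
    exact f.preimage_mono (Proj.basicOpen_mono _ _ _ h2)
  obtain ⟨m, G, hG, hGθ⟩ := Away.mk_surjective (grading 2 K) hF.homogeneous
    (θ (Away.mk (grading 2 K) hH.homogeneous e' H' hH'e))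
  have hG0 : G ≠ 0 := by
    rintro rfl
    rw [(away_mk_eq_zero_iff _ hF.prime.ne_zero hG).2 rfl, eq_comm, map_eq_zero_iff _ θ.injective,
      away_mk_eq_zero_iff _ hH.prime.ne_zero] at hGθ
    exact hH'.prime.ne_zero hGθ
  have hF'G : F' ∣ G := by
    have h1 := preimage_basicOpen_mul_eq h hθ hH'e hG hGθ.symm
    have h2 : F' ∣ F * G := by
      refine hF'.dvd_of_basicOpen_le (H := F') (SetLike.mul_mem_graded hF.homogeneous hG) ?_ dvd_rfl
      rw [← h1, ← h']
      exact f.preimage_mono (Proj.basicOpen_mono _ _ _ (dvd_mul_left _ _))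
    exact (hF'.prime.dvd_or_dvd h2).resolve_left hF'F
  obtain ⟨G', g', hG', rfl, hdeg⟩ := exists_isHomogeneous_of_dvd hF'.homogeneous hG hG0 hF'G
  have key : ∀ j : Fin 3, ∃ N, G' ∣ X j ^ (d' * (d - 1)) * F ^ N := by
    intro j
    -- The exponent raises the degree from d' to d' d, so that division by F ^ d' gives a function
    -- on the chart.
    have ht : F' * X j ^ (d' * (d - 1)) ∈ grading 2 K (d' • d) := by
      have := SetLike.mul_mem_graded hF'.homogeneous (SetLike.pow_mem_graded (d' * (d - 1))
        (X_mem_grading K j))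
      have hdd : d' • d = d' + (d' * (d - 1)) • 1 := by
        obtain ⟨d, rfl⟩ := Nat.exists_eq_succ_of_ne_zero hd.ne'
        simp [Nat.mul_succ, add_comm]
      rwa [hdd]
    obtain ⟨u, hu⟩ := θ.surjective (Away.mk (grading 2 K) hF.homogeneous d' _ ht)
    obtain ⟨l, U, hU, rfl⟩ := Away.mk_surjective (grading 2 K) hH.homogeneous u
    have hH'U : H' ∣ U := by
      have h1 := preimage_basicOpen_mul_eq h hθ hU ht hu
      have h2 : H' ∣ H * U := by
        refine hH'.dvd_of_basicOpen_le (H := H') (SetLike.mul_mem_graded hH.homogeneous hU) ?_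
          dvd_rfl
        refine hle ?_
        rw [h1, h']
        exact Proj.basicOpen_mono _ _ _ ((dvd_mul_right _ _).trans (dvd_mul_left _ _))
      exact (hH'.prime.dvd_or_dvd h2).resolve_left hHH'
    by_cases hU0 : U = 0
    · exfalso
      subst hU0
      rw [(away_mk_eq_zero_iff _ hH.prime.ne_zero hU).2 rfl, map_zero, eq_comm,
        away_mk_eq_zero_iff _ hF.prime.ne_zero] at hu
      exact mul_ne_zero hF'.prime.ne_zero (pow_ne_zero _ (X_ne_zero _)) hu
    obtain ⟨V, v, hV, rfl, hl⟩ := exists_isHomogeneous_of_dvd hH'.homogeneous hU hU0 hH'U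
    have hV' : V ∈ grading 2 K (v • 1) := by simpa using hV
    obtain ⟨r, Z, hZ, hZθ⟩ := Away.mk_surjective (grading 2 K) hF.homogeneous
      (θ (Away.mk (grading 2 K) hH.homogeneous v V hV'))
    have hl' : l = e' + v := by simpa using hl
    subst hl'
    have h3 : Away.mk (grading 2 K) hF.homogeneous d' _ ht =
        Away.mk (grading 2 K) hF.homogeneous m _ hG *
          Away.mk (grading 2 K) hF.homogeneous r _ hZ := by
      rw [hGθ, hZθ, ← map_mul, away_mk_mul_mk, hu]
    rw [away_mk_mul_mk, away_mk_eq_mk_iff _ hF.prime.ne_zero] at h3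
    refine ⟨m + r, ?_⟩
    have h4 : F' * (X j ^ (d' * (d - 1)) * F ^ (m + r)) = F' * (G' * (Z * F ^ d')) := by
      rw [← mul_assoc, h3]
      ring
    exact Dvd.intro _ (mul_left_cancel₀ hF'.prime.ne_zero h4).symm
  obtain ⟨N₀, hN₀⟩ := key 0
  obtain ⟨N₁, hN₁⟩ := key 1
  obtain ⟨c, a, hc0, rfl, ha⟩ := hF.exists_eq_C_mul_pow (M := d' * (d - 1)) (N := N₀ + N₁) hG'
    (right_ne_zero_of_mul hG0)
    (hN₀.trans (mul_dvd_mul_left _ (pow_dvd_pow _ (Nat.le_add_right _ _))))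
    (hN₁.trans (mul_dvd_mul_left _ (pow_dvd_pow _ (Nat.le_add_left _ _))))
  have ham : a ≤ m := by
    have h1 : a * d ≤ m * d := by
      rw [smul_eq_mul] at hdeg
      omega
    exact Nat.le_of_mul_le_mul_right h1 hd
  obtain ⟨b, rfl⟩ := Nat.exists_eq_add_of_le ham
  have hd'b : d' = b * d := by
    rw [smul_eq_mul, add_mul] at hdeg
    omega
  have hcb : C c * F' ∈ grading 2 K (b • d) := by
    rw [smul_eq_mul, ← hd'b]
    exact hF'.homogeneous.C_mul c
  refine ⟨c, b, hcb, hc0, hd'b, ?_⟩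
  rw [← hGθ, away_mk_eq_mk_iff _ hF.prime.ne_zero]
  ring

end Automorphisms

/-! ### The matrix of an automorphism -/

section LinearAutomorphisms

open MvPolynomial HomogeneousLocalization

variable {K : Type u} [Field K]

theorem irrelevant_le_span_X (K : Type u) [Field K] :
    (HomogeneousIdeal.irrelevant (grading 2 K)).toIdeal ≤
      Ideal.span (Set.range (X : Fin 3 → MvPolynomial (Fin 3) K)) := by
  rw [HomogeneousIdeal.toIdeal_irrelevant_le]
  intro i hi G hG
  rw [← Set.image_univ]
  refine mem_ideal_span_X_image.2 fun m hm => ?_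
  by_contra! h
  have hm0 : m = 0 := by
    ext j
    simpa using h j (Set.mem_univ j)
  refine mem_support_iff.1 hm ?_
  refine IsHomogeneous.coeff_eq_zero (n := i) hG ?_
  rw [hm0]
  simpa using hi.ne

/-- The standard affine cover of `ℙ²`. -/
noncomputable def standardCover (K : Type u) [Field K] : (Proj (grading 2 K)).AffineOpenCover :=
  Proj.affineOpenCoverOfIrrelevantLESpan (grading 2 K) (X : Fin 3 → MvPolynomial (Fin 3) K)
    (X_mem_grading K) (fun _ => Nat.one_pos) (irrelevant_le_span_X K)

instance isReduced_projectivePlane : IsReduced (Proj (grading 2 K)) := by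
  have h : ∀ i, IsReduced ((standardCover K).openCover.X i) := fun i => by
    have : _root_.IsReduced (Away (grading 2 K) (X i : MvPolynomial (Fin 3) K)) :=
      have : IsDomain (Localization.Away (X i : MvPolynomial (Fin 3) K)) :=
        IsLocalization.isDomain_localization
          (powers_le_nonZeroDivisors_of_noZeroDivisors (X_ne_zero i))
      isReduced_of_injective (algebraMap _ (Localization.Away (X i : MvPolynomial (Fin 3) K)))
        (HomogeneousLocalization.val_injective _)
    change IsReduced (Spec (CommRingCat.of (Away (grading 2 K) (X i : MvPolynomial (Fin 3) K))))
    infer_instance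
  exact IsReduced.of_openCover _ (standardCover K).openCover

/-- A nonempty basic open contains the generic point and is dense; morphisms from a reduced scheme
to a separated one are determined on a dense open. -/
theorem ext_of_awayι {Y : Scheme.{u}} [Y.IsSeparated] {f g : Proj (grading 2 K) ⟶ Y}
    {F : MvPolynomial (Fin 3) K} {d : ℕ} (hF : F ∈ grading 2 K d) (hd : 0 < d) (hF0 : F ≠ 0)
    (h : Proj.awayι (grading 2 K) F hF hd ≫ f = Proj.awayι (grading 2 K) F hF hd ≫ g) : f = g := by
  have : IsDominant (Proj.awayι (grading 2 K) F hF hd) := by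
    refine ⟨fun x => ?_⟩
    have hx : x ∈ closure {genericPt K} := (genericPt_specializes x).mem_closure
    refine closure_mono (Set.singleton_subset_iff.2 ?_) hx
    have := genericPt_mem_basicOpen hF0
    rwa [← Proj.opensRange_awayι (grading 2 K) F hF hd] at this
  exact ext_of_isDominant _ h

theorem linearHom_X (A : Matrix (Fin 3) (Fin 3) K) (i : Fin 3) :
    linearHom (n := 2) A (X i) = ∑ j, C (A i j) * X j := by
  rw [linearHom_apply, aeval_X]

theorem linearHom_C (A : Matrix (Fin 3) (Fin 3) K) (c : K) :
    linearHom (n := 2) A (C c) = C c := by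
  rw [linearHom_apply, algHom_C]
  rfl

theorem linearHom_ne_zero (A : GL (Fin 3) K) {F : MvPolynomial (Fin 3) K} (hF : F ≠ 0) :
    linearHom (n := 2) (A : Matrix (Fin 3) (Fin 3) K) F ≠ 0 := by
  intro h
  apply hF
  have := linearHom_linearHom (n := 2) ((A⁻¹ : GL (Fin 3) K) : Matrix (Fin 3) (Fin 3) K) A F
  rw [h, map_zero, ← Units.val_mul, mul_inv_cancel, Units.val_one, linearHom_one] at this
  exact this.symm

theorem linearHom_mem (A : Matrix (Fin 3) (Fin 3) K) {F : MvPolynomial (Fin 3) K} {d : ℕ}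
    (hF : F ∈ grading 2 K d) : linearHom (n := 2) A F ∈ grading 2 K d :=
  (linearHom (n := 2) A).map_mem hF

theorem awayι_comp_linearMap (A : GL (Fin 3) K) (i : Fin 3) :
    Proj.awayι (grading 2 K) (linearHom (n := 2) (A : Matrix (Fin 3) (Fin 3) K) (X i))
      (linearHom_mem _ (X_mem_grading K i)) Nat.one_pos ≫ linearMap A =
    Spec.map (CommRingCat.ofHom (Away.map (linearHom (n := 2) (A : Matrix (Fin 3) (Fin 3) K))
      (X i))) ≫ Proj.awayι (grading 2 K) (X i) (X_mem_grading K i) Nat.one_pos :=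
  Proj.awayι_comp_map _ _ Nat.one_pos _ (X_mem_grading K i)

/-- By density one chart suffices, and there the constants and the X_j/X_i determine the ring map.
`F` is a variable tied down by `hFA` because in the applications the line comes with another
expression. -/
theorem eq_linearMap_of_awayι (A : GL (Fin 3) K) (i : Fin 3)
    (f : Proj (grading 2 K) ⟶ Proj (grading 2 K)) {F : MvPolynomial (Fin 3) K}
    (hF : F ∈ grading 2 K 1)
    (hFA : F = linearHom (n := 2) (A : Matrix (Fin 3) (Fin 3) K) (X i))
    (θ : Away (grading 2 K) (X i : MvPolynomial (Fin 3) K) →+* Away (grading 2 K) F)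
    (hθ : Spec.map (CommRingCat.ofHom θ) ≫
        Proj.awayι (grading 2 K) (X i) (X_mem_grading K i) Nat.one_pos =
      Proj.awayι (grading 2 K) F hF Nat.one_pos ≫ f)
    (hC : ∀ c, θ (awayC _ c) = awayC _ c)
    (hX : ∀ j, θ (awayX i j) = Away.mk (grading 2 K) hF 1
      (linearHom (n := 2) (A : Matrix (Fin 3) (Fin 3) K) (X j))
      (linearHom_mem _ (by simpa using X_mem_grading K j))) :
    f = linearMap A := by
  subst hFA
  refine ext_of_awayι (linearHom_mem _ (X_mem_grading K i)) Nat.one_pos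
    (linearHom_ne_zero A (X_ne_zero i)) ?_
  refine hθ.symm.trans (Eq.trans ?_ (awayι_comp_linearMap A i).symm)
  congr 3
  refine away_X_hom_ext i (fun c => ?_) fun j => ?_
  · rw [hC, awayC_eq_mk (linearHom_mem _ (X_mem_grading K i)), awayC_eq_mk (X_mem_grading K i),
      Away.map_mk]
    congr 1
    exact (linearHom_C _ c).symm
  · rw [hX, awayX, Away.map_mk]

theorem awayC_comp_of_over {f : Proj (grading 2 K) ⟶ Proj (grading 2 K)}
    (hf : f ≫ planeHom K = planeHom K)
    {F H : MvPolynomial (Fin 3) K} {d e : ℕ} {hF : F ∈ grading 2 K d} {hH : H ∈ grading 2 K e}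
    {hd : 0 < d} {he : 0 < e} {θ : Away (grading 2 K) H →+* Away (grading 2 K) F}
    (hθ : Spec.map (CommRingCat.ofHom θ) ≫ Proj.awayι (grading 2 K) H hH he =
        Proj.awayι (grading 2 K) F hF hd ≫ f) (c : K) : θ (awayC H c) = awayC F c := by
  have h := congrArg (· ≫ planeHom K) hθ
  simp only [Category.assoc, hf] at h
  rw [awayι_planeHom, awayι_planeHom, ← Spec.map_comp] at h
  exact congrArg (fun a => a.hom c) (Spec.map_injective h)

theorem sum_awayC_mul_mk {F : MvPolynomial (Fin 3) K} (hF : F ∈ grading 2 K 1)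
    (v : Fin 3 → K) {G : Fin 3 → MvPolynomial (Fin 3) K} (hG : ∀ i, G i ∈ grading 2 K (1 • 1)) :
    ∑ i, awayC F (v i) * Away.mk (grading 2 K) hF 1 (G i) (hG i) =
      Away.mk (grading 2 K) hF 1 (∑ i, C (v i) * G i)
        (Submodule.sum_mem _ fun i _ => (IsHomogeneous.C_mul (hG i) (v i))) := by
  let φ := algebraMap (Away (grading 2 K) F) (Localization.Away F)
  have hφ : ∀ y, y.val = φ y := fun y => (HomogeneousLocalization.algebraMap_apply y).symm
  rw [HomogeneousLocalization.ext_iff_val, hφ, map_sum]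
  simp only [map_mul]
  simp only [← hφ, awayC_val, Away.val_mk, Localization.mk_eq_mk'_apply]
  simp only [IsLocalization.mk'_eq_mul_mk'_one (∑ i, C (v i) * G i),
    fun i => IsLocalization.mk'_eq_mul_mk'_one (M := Submonoid.powers F)
      (S := Localization.Away F) (G i)]
  rw [map_sum, Finset.sum_mul]
  simp only [map_mul, mul_assoc]

theorem linearForm_eq_sum {G : MvPolynomial (Fin 3) K} (hG : G ∈ grading 2 K 1) :
    ∃ v : Fin 3 → K, G = ∑ j, C (v j) * X j := by
  have h : G ∈ Submodule.span K (Set.range X) := by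
    rw [← homogeneousSubmodule_one_eq_span_X]
    exact hG
  obtain ⟨v, rfl⟩ := (Submodule.mem_span_range_iff_exists_fun K).1 h
  exact ⟨v, Finset.sum_congr rfl fun j _ => smul_eq_C_mul _ _⟩

theorem linearForm_eq_zero {v : Fin 3 → K}
    (h : ∑ j, C (v j) * X j = (0 : MvPolynomial (Fin 3) K)) : v = 0 := by
  funext i
  have := congrArg (eval (Pi.single i (1 : K))) h
  simpa [Pi.single_apply] using this

/-- A coordinate X j not divisible by F is itself the pullback of a curve under f. So the degree of
F divides the degree of X j, which is 1. -/
theorem preimage_X_degree_eq_one {f : Proj (grading 2 K) ⟶ Proj (grading 2 K)} [IsIso f]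
    {i : Fin 3} {F : MvPolynomial (Fin 3) K} {d : ℕ} (hF : IsHomogeneousPrime (n := 2) F d)
    (h : f ⁻¹ᵁ Proj.basicOpen (grading 2 K) (X i) = Proj.basicOpen (grading 2 K) F) : d = 1 := by
  obtain ⟨j, hj⟩ := hF.exists_X_notMem
  rw [Ideal.mem_span_singleton] at hj
  obtain ⟨H, e, hH, hjH⟩ :=
    (isHomogeneousPrime_X (n := 2) (K := K) j).exists_preimage_basicOpen_eq (inv f)
  have h' : f ⁻¹ᵁ Proj.basicOpen (grading 2 K) H = Proj.basicOpen (grading 2 K) (X j) := by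
    rw [← hjH, ← Scheme.Hom.comp_preimage, IsIso.hom_inv_id]
    rfl
  obtain ⟨θ, hθ⟩ := exists_away_ringEquiv f hF.homogeneous (X_mem_grading K i) hF.pos
    Nat.one_pos h
  obtain ⟨c, m, -, -, hm, -⟩ := hF.mk_eq_of_preimage (isHomogeneousPrime_X j)
    (isHomogeneousPrime_X i) hH h h' hj hθ
  exact Nat.eq_one_of_dvd_one (Dvd.intro_left m hm.symm)

/-- Every `K`-automorphism of `ℙ²_K` is given by a matrix. -/
theorem exists_eq_linearMap (f : Proj (grading 2 K) ⟶ Proj (grading 2 K)) [IsIso f]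
    (hf : f ≫ planeHom K = planeHom K) : ∃ A : GL (Fin 3) K, f = linearMap A := by
  choose F d hF hpre using fun i : Fin 3 =>
    (isHomogeneousPrime_X (n := 2) (K := K) i).exists_preimage_basicOpen_eq f
  obtain rfl : d = fun _ => 1 := funext fun i => preimage_X_degree_eq_one (hF i) (hpre i)
  have hF0 : F 0 ≠ 0 := (hF 0).prime.ne_zero
  obtain ⟨θ, hθ⟩ := exists_away_ringEquiv f (hF 0).homogeneous (X_mem_grading K 0) Nat.one_pos
    Nat.one_pos (hpre 0)
  have hθC : ∀ c, θ (awayC (X 0) c) = awayC (F 0) c := awayC_comp_of_over hf hθ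
  have hmk : ∀ (G : MvPolynomial (Fin 3) K) (hG : G ∈ grading 2 K 1) (hG0 : G ≠ 0)
      (hG' : G ∈ grading 2 K (1 • 1)), Away.mk (grading 2 K) hG 1 G hG' = 1 := by
    intro G hG hG0 hG'
    rw [← (awayC G).map_one, awayC_eq_mk hG, away_mk_eq_mk_iff hG hG0]
    simp
  have h00 : θ (awayX 0 0) = Away.mk (grading 2 K) (hF 0).homogeneous 1 (F 0)
      (by simpa using (hF 0).homogeneous) := by
    rw [awayX, hmk _ _ (X_ne_zero 0), hmk _ _ hF0, map_one]
  have key : ∀ i : Fin 3, ∃ (G : MvPolynomial (Fin 3) K) (hG : G ∈ grading 2 K (1 • 1)),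
      θ (awayX 0 i) = Away.mk (grading 2 K) (hF 0).homogeneous 1 G hG := by
    intro i
    by_cases hi : i = 0
    · subst hi
      exact ⟨F 0, by simpa using (hF 0).homogeneous, h00⟩
    -- If F 0 divided F i, the locus X i ≠ 0 would lie in X 0 ≠ 0, because f is surjective, and X 0
    -- would divide X i.
    · have hne : ¬ F 0 ∣ F i := fun h => hi <| by
        have h1 : (X 0 : MvPolynomial (Fin 3) K) ∣ X i := by
          refine (isHomogeneousPrime_X (n := 2) (0 : Fin 3)).dvd_of_basicOpen_le (H := X 0)
            (X_mem_grading K i) ?_ dvd_rfl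
          intro y hy
          obtain ⟨x, rfl⟩ := f.surjective y
          have h2 : x ∈ f ⁻¹ᵁ Proj.basicOpen (grading 2 K) (X i) := hy
          rw [hpre] at h2
          have h3 := Proj.basicOpen_mono (grading 2 K) _ _ h h2
          rw [← hpre] at h3
          exact h3
        exact ((isHomogeneousPrime_X (n := 2) (0 : Fin 3)).dvd_of_dvd_X dvd_rfl h1).symm
      obtain ⟨c, m, hc, -, hm, h⟩ := (hF 0).mk_eq_of_preimage (hF i)
        (isHomogeneousPrime_X 0) (isHomogeneousPrime_X i) (hpre 0) (hpre i) hne hθ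
      obtain rfl : m = 1 := by simpa using hm.symm
      exact ⟨_, hc, h⟩
  choose G hG hθG using key
  choose A hA using fun i => linearForm_eq_sum (by simpa using hG i)
  -- A relation v between the rows gives ∑ v_i G_i = 0. Injectivity of θ then gives ∑ v_i X_i = 0,
  -- so v = 0.
  have hdet : (Matrix.of A).det ≠ 0 := by
    intro h0
    obtain ⟨v, hv0, hv⟩ := Matrix.exists_vecMul_eq_zero_iff.2 h0
    refine hv0 (linearForm_eq_zero ?_)
    have h1 : ∑ i, C (v i) * G i = 0 := by
      simp only [hA, Finset.mul_sum, ← mul_assoc]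
      rw [Finset.sum_comm]
      refine Finset.sum_eq_zero fun j _ => ?_
      rw [← Finset.sum_mul]
      have := congrFun hv j
      simp only [Matrix.vecMul, dotProduct, Matrix.of_apply, Pi.zero_apply] at this
      simp only [← C_mul, ← map_sum, this, C_0, zero_mul]
    have h2 : θ (∑ i, awayC (X 0) (v i) * awayX 0 i) = 0 := by
      simp only [map_sum, map_mul, hθG, hθC]
      rw [sum_awayC_mul_mk (hF 0).homogeneous v hG, away_mk_eq_zero_iff _ hF0, h1]
    rw [map_eq_zero_iff _ θ.injective] at h2
    simp only [awayX] at h2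
    rwa [sum_awayC_mul_mk (X_mem_grading K 0) v, away_mk_eq_zero_iff _ (X_ne_zero 0)] at h2
  let A' : GL (Fin 3) K := Matrix.GeneralLinearGroup.mkOfDetNeZero (Matrix.of A) hdet
  have hA' : ∀ i, G i = linearHom (n := 2) (A' : Matrix (Fin 3) (Fin 3) K) (X i) := fun i => by
    rw [linearHom_X, hA]
    rfl
  have hG0 : F 0 = linearHom (n := 2) (A' : Matrix (Fin 3) (Fin 3) K) (X 0) := by
    rw [hθG, away_mk_eq_mk_iff _ hF0] at h00
    rw [← hA']
    exact (mul_right_cancel₀ (pow_ne_zero _ hF0) h00).symm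
  refine ⟨A', eq_linearMap_of_awayι A' 0 f (hF 0).homogeneous hG0 θ hθ hθC fun j => ?_⟩
  refine (hθG j).trans ?_
  simp only [hA']

end LinearAutomorphisms

/-! ### The homomorphism A ↦ [A] and its kernel -/

section LinearMaps

open MvPolynomial HomogeneousLocalization

variable {K : Type u} [Field K]

theorem proj_map_congr {A B σ τ : Type u} [CommRing A] [SetLike σ A] [AddSubgroupClass σ A]
    [CommRing B] [SetLike τ B] [AddSubgroupClass τ B] {𝒜 : ℕ → σ} {ℬ : ℕ → τ} [GradedRing 𝒜]
    [GradedRing ℬ] {f f' : 𝒜 →+*ᵍ ℬ}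
    {hf : HomogeneousIdeal.irrelevant ℬ ≤ (HomogeneousIdeal.irrelevant 𝒜).map f}
    {hf' : HomogeneousIdeal.irrelevant ℬ ≤ (HomogeneousIdeal.irrelevant 𝒜).map f'}
    (h : ∀ x, f x = f' x) : Proj.map f hf = Proj.map f' hf' := by
  obtain rfl : f = f' := DFunLike.ext _ _ h
  rfl

theorem proj_map_planeHom {M : Type u} [Field M] (i : K →+* M) (f : grading 2 K →+*ᵍ grading 2 M)
    (hf : HomogeneousIdeal.irrelevant (grading 2 M) ≤
      (HomogeneousIdeal.irrelevant (grading 2 K)).map f)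
    (h : ∀ c, f (C c) = C (i c)) :
    Proj.map f hf ≫ planeHom K = planeHom M ≫ Spec.map (CommRingCat.ofHom i) := by
  have key : ∀ (s : MvPolynomial (Fin 3) K) (d : ℕ) (hs : s ∈ grading 2 K d) (hd : 0 < d),
      Proj.awayι (grading 2 M) (f s) (f.2 hs) hd ≫ Proj.map f hf ≫ planeHom K =
        Proj.awayι (grading 2 M) (f s) (f.2 hs) hd ≫ planeHom M ≫
          Spec.map (CommRingCat.ofHom i) := by
    intro s d hs hd
    rw [← Category.assoc, ← Category.assoc, awayι_planeHom, Proj.awayι_comp_map f hf hd _ hs,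
      Category.assoc, awayι_planeHom, ← Spec.map_comp, ← Spec.map_comp]
    congr 1
    refine CommRingCat.hom_ext (RingHom.ext fun c => ?_)
    change Away.map f _ (awayC _ c) = awayC _ (i c)
    rw [awayC_eq_mk hs, Away.map_mk]
    refine Eq.trans ?_ (awayC_eq_mk (F := f s) (f.2 hs) (i c)).symm
    congr 1
    exact h c
  exact (Proj.mapAffineOpenCover f hf).openCover.hom_ext _ _ fun s => key s.2 s.1 s.2.2 s.1.2

theorem linearMap_comp_linearMap (A B : GL (Fin 3) K) :
    linearMap A ≫ linearMap B = linearMap (B * A) := by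
  refine (Proj.map_comp (linearHom (n := 2) (B : Matrix (Fin 3) (Fin 3) K))
    (linearHom (n := 2) (A : Matrix (Fin 3) (Fin 3) K)) _ _).symm.trans ?_
  exact proj_map_congr fun x =>
    linearHom_linearHom (n := 2) (A : Matrix (Fin 3) (Fin 3) K) (B : Matrix (Fin 3) (Fin 3) K) x

theorem linearMap_one : linearMap (1 : GL (Fin 3) K) = 𝟙 _ := by
  refine Eq.trans (proj_map_congr fun x => ?_) (Proj.map_id (𝒜 := grading 2 K))
  exact linearHom_one (n := 2) x

theorem linearMap_planeHom (A : GL (Fin 3) K) :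
    linearMap A ≫ planeHom K = planeHom K := by
  refine (proj_map_planeHom (RingHom.id K) _ _ (linearHom_C _)).trans ?_
  erw [Spec.map_id, Category.comp_id]

/-- On the chart where c X_0 ≠ 0 this is the identity X_j/X_0 = (c X_j)/(c X_0). -/
theorem linearMap_eq_id_of_smul {A : GL (Fin 3) K} {c : K}
    (hA : (A : Matrix (Fin 3) (Fin 3) K) = c • (1 : Matrix (Fin 3) (Fin 3) K)) :
    linearMap A = 𝟙 _ := by
  have hX : ∀ i, linearHom (n := 2) (A : Matrix (Fin 3) (Fin 3) K) (X i) = X i * C c := by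
    intro i
    rw [linearHom_X, hA]
    simp [Matrix.one_apply, mul_comm, apply_ite C]
  symm
  refine eq_linearMap_of_awayι A 0 (𝟙 _) (F := X 0 * C c) ?_ (hX 0).symm
    (awayMap (grading 2 K) (isHomogeneous_C _ c : C c ∈ grading 2 K 0) rfl) ?_ ?_ ?_
  · rw [mul_comm]
    exact IsHomogeneous.C_mul (X_mem_grading K 0) c
  · rw [Category.comp_id]
    exact Proj.SpecMap_awayMap_awayι _ _ _ _ _
  · intro c
    exact awayMap_fromZeroRingHom _ _ _ _
  · intro j
    refine (awayMap_mk _ _ _ _ _ _ _).trans ?_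
    congr 1
    simp [hX]

/-- The point of `ℙ²` with given coordinates. -/
noncomputable def rationalPoint (v : Fin 3 → K) (hv : v ≠ 0) : Proj (grading 2 K) :=
  corePoint (RingHom.ker (eval v)) (RingHom.ker_isPrime _) (by
    obtain ⟨i, hi⟩ := Function.ne_iff.1 hv
    exact ⟨i, by simpa using hi⟩)

theorem rationalPoint_mem_basicOpen {v : Fin 3 → K} (hv : v ≠ 0) {G : MvPolynomial (Fin 3) K}
    {e : ℕ} (hG : G ∈ grading 2 K e) :
    rationalPoint v hv ∈ Proj.basicOpen (grading 2 K) G ↔ eval v G ≠ 0 :=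
  (mem_corePoint _ _ hG).not

/-- The identity preserves every line, so A v lies on all lines through v. Unit vectors v kill the
off-diagonal entries, and v = (1, 1, 1) makes the diagonal constant. -/
theorem exists_smul_of_linearMap_eq_id {A : GL (Fin 3) K} (h : linearMap A = 𝟙 _) :
    ∃ c : K, (A : Matrix (Fin 3) (Fin 3) K) = c • (1 : Matrix (Fin 3) (Fin 3) K) := by
  have key : ∀ (v : Fin 3 → K) (hv : v ≠ 0) (w : Fin 3 → K),
      w ⬝ᵥ v = 0 → w ⬝ᵥ ((A : Matrix (Fin 3) (Fin 3) K).mulVec v) = 0 := by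
    intro v hv w hw
    set G : MvPolynomial (Fin 3) K := ∑ j, C (w j) * X j with hGdef
    have hG : G ∈ grading 2 K 1 :=
      Submodule.sum_mem _ fun i _ => IsHomogeneous.C_mul (X_mem_grading K i) (w i)
    have h1 : Proj.basicOpen (grading 2 K) (linearHom (n := 2) (A : Matrix (Fin 3) (Fin 3) K) G) =
        Proj.basicOpen (grading 2 K) G := by
      change linearMap A ⁻¹ᵁ Proj.basicOpen (grading 2 K) G = _
      rw [h]
      rfl
    have h2 : rationalPoint v hv ∉ Proj.basicOpen (grading 2 K) G := by
      rw [rationalPoint_mem_basicOpen hv hG]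
      simpa [hGdef, dotProduct] using hw
    rw [← h1, rationalPoint_mem_basicOpen hv (linearHom_mem _ hG), not_not] at h2
    rw [hGdef] at h2
    simp only [map_sum, map_mul, linearHom_X, linearHom_C, eval_C, eval_X] at h2
    exact h2
  have hoff : ∀ i j, i ≠ j → A i j = 0 := by
    intro i j hij
    have := key (Pi.single j 1) (by simp) (Pi.single i 1) (by simp [hij.symm])
    simpa using this
  have hdiag : ∀ i, A i i = A 0 0 := by
    intro i
    have := key 1 one_ne_zero (Pi.single i 1 - Pi.single 0 1) (by simp [sub_dotProduct])
    rw [sub_dotProduct, single_dotProduct, single_dotProduct, one_mul, one_mul, sub_eq_zero] at this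
    have h3 : ∀ i, ((A : Matrix (Fin 3) (Fin 3) K).mulVec 1) i = A i i := fun i => by
      simp only [Matrix.mulVec, dotProduct, Pi.one_apply, mul_one]
      exact Finset.sum_eq_single i (fun j _ hj => hoff i j hj.symm) (by simp)
    rwa [h3, h3] at this
  refine ⟨A 0 0, ?_⟩
  ext i j
  by_cases hij : i = j
  · subst hij
    simpa using hdiag i
  · simpa [hij] using hoff i j hij

theorem linearMap_eq_linearMap_iff {A B : GL (Fin 3) K} :
    linearMap A = linearMap B ↔
      ∃ c : Kˣ, (B : Matrix (Fin 3) (Fin 3) K) = (c : K) • (A : Matrix (Fin 3) (Fin 3) K) := by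
  have h1 : linearMap A = linearMap B ↔ linearMap (B * A⁻¹) = 𝟙 _ := by
    rw [← linearMap_comp_linearMap]
    constructor
    · intro h
      rw [← h, linearMap_comp_linearMap, mul_inv_cancel, linearMap_one]
    · intro h
      have := congrArg (linearMap A ≫ ·) h
      simp only [← Category.assoc, linearMap_comp_linearMap A A⁻¹, inv_mul_cancel,
        linearMap_one] at this
      simpa using this.symm
  rw [h1]
  constructor
  · intro h
    obtain ⟨c, hc⟩ := exists_smul_of_linearMap_eq_id h
    have hc0 : c ≠ 0 := by
      rintro rfl
      rw [zero_smul] at hc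
      exact (B * A⁻¹).ne_zero hc
    refine ⟨Units.mk0 c hc0, ?_⟩
    calc (B : Matrix (Fin 3) (Fin 3) K) = ((B * A⁻¹ : GL (Fin 3) K) : Matrix (Fin 3) (Fin 3) K) *
          (A : Matrix (Fin 3) (Fin 3) K) := by
          rw [← Units.val_mul, inv_mul_cancel_right]
      _ = _ := by rw [hc, smul_mul_assoc, one_mul]; rfl
  · rintro ⟨c, hc⟩
    refine linearMap_eq_id_of_smul (c := c) ?_
    rw [Units.val_mul, hc, smul_mul_assoc, ← Units.val_mul, mul_inv_cancel, Units.val_one]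

end LinearMaps

/-! ### Extension of scalars -/

section Extension

open MvPolynomial HomogeneousLocalization

variable {K M N : Type u} [Field K] [Field M] [Field N]

/-- The graded ring homomorphism `K[x₀, x₁, x₂] → M[x₀, x₁, x₂]` induced by `K → M`. -/
noncomputable def coeffExt (i : K →+* M) : grading 2 K →+*ᵍ grading 2 M where
  __ := MvPolynomial.map (σ := Fin 3) i
  map_mem := fun {_ _} hx => MvPolynomial.IsHomogeneous.map hx _

theorem coeffExt_apply (i : K →+* M) (p : MvPolynomial (Fin 3) K) :
    coeffExt i p = MvPolynomial.map i p := rfl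

theorem irrelevant_le_map_coeffExt (i : K →+* M) :
    HomogeneousIdeal.irrelevant (grading 2 M) ≤
      (HomogeneousIdeal.irrelevant (grading 2 K)).map (coeffExt i) := by
  refine (irrelevant_le_span_X M).trans ?_
  rw [Ideal.span_le]
  rintro _ ⟨j, rfl⟩
  have := Ideal.mem_map_of_mem (coeffExt i)
    (HomogeneousIdeal.mem_irrelevant_of_mem (grading 2 K) Nat.one_pos (X_mem_grading K j))
  rwa [coeffExt_apply, map_X] at this

/-- The projection `ℙ²_M ⟶ ℙ²_K` induced by `K → M`. -/
noncomputable def planeExt (i : K →+* M) : Proj (grading 2 M) ⟶ Proj (grading 2 K) :=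
  Proj.map (coeffExt i) (irrelevant_le_map_coeffExt i)

theorem galoisPlane_eq_planeExt (g : K ≃+* K) : galoisPlane g = planeExt (g.symm : K →+* K) :=
  proj_map_congr fun _ => rfl

theorem planeExt_comp_planeExt (i : K →+* M) (j : M →+* N) :
    planeExt j ≫ planeExt i = planeExt (j.comp i) := by
  refine (Proj.map_comp (coeffExt i) (coeffExt j) _ _).symm.trans ?_
  exact proj_map_congr fun x => MvPolynomial.map_map i j x

theorem planeExt_id : planeExt (RingHom.id K) = 𝟙 _ := by
  refine Eq.trans (proj_map_congr fun x => ?_) (Proj.map_id (𝒜 := grading 2 K))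
  exact MvPolynomial.map_id x

theorem planeExt_planeHom (i : K →+* M) :
    planeExt i ≫ planeHom K = planeHom M ≫ Spec.map (CommRingCat.ofHom i) :=
  proj_map_planeHom i _ _ fun c => map_C i c

theorem planeExt_comp_linearMap (i : K →+* M) (A : GL (Fin 3) K) :
    planeExt i ≫ linearMap A = linearMap (Matrix.GeneralLinearGroup.map i A) ≫ planeExt i := by
  refine (Proj.map_comp (linearHom (n := 2) (A : Matrix (Fin 3) (Fin 3) K))
    (coeffExt i) _ _).symm.trans (Eq.trans (proj_map_congr fun x => ?_)
    (Proj.map_comp (coeffExt i) (linearHom (n := 2)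
      ((Matrix.GeneralLinearGroup.map i A : GL (Fin 3) M) : Matrix (Fin 3) (Fin 3) M)) _ _))
  change MvPolynomial.map i (linearHom (n := 2) _ x) = linearHom (n := 2) _ (MvPolynomial.map i x)
  induction x using MvPolynomial.induction_on with
  | C a => rw [linearHom_C, map_C, linearHom_C]
  | add p q hp hq => rw [map_add, map_add, map_add, map_add, hp, hq]
  | mul_X p j hp =>
    rw [map_mul, map_mul, map_mul, map_mul, hp, map_X, linearHom_X, linearHom_X, map_sum]
    simp [MvPolynomial.map_X]

/-- Evaluate M[x₀, x₁, x₂] at the values prescribed by a. X j goes to 1, so the evaluation extends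
to the localization. This supplies the map out of the pushout in `isPushout_away`. -/
theorem exists_away_desc (j : Fin 3) {T : Type*} [CommRing T]
    (a : Away (grading 2 K) (X j : MvPolynomial (Fin 3) K) →+* T) (b : M →+* T) :
    ∃ d : Away (grading 2 M) (X j : MvPolynomial (Fin 3) M) →+* T,
      (∀ c, d (awayC _ c) = b c) ∧ ∀ l, d (awayX j l) = a (awayX j l) := by
  let e : MvPolynomial (Fin 3) M →+* T := eval₂Hom b fun l => a (awayX j l)
  have hej : e (X j) = 1 := by
    have h1 : (awayX j j : Away (grading 2 K) (X j : MvPolynomial (Fin 3) K)) = 1 := by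
      rw [← (awayC (X j : MvPolynomial (Fin 3) K)).map_one, awayX, awayC_eq_mk (X_mem_grading K j),
        away_mk_eq_mk_iff (X_mem_grading K j) (X_ne_zero j)]
      simp
    simp [e, h1]
  have hu : IsUnit (e (X j)) := by rw [hej]; exact isUnit_one
  let D : Localization.Away (X j : MvPolynomial (Fin 3) M) →+* T :=
    IsLocalization.Away.lift (X j) hu
  have hD : ∀ p, D (algebraMap _ _ p) = e p := fun p => IsLocalization.Away.lift_eq _ hu p
  let φ := algebraMap (Away (grading 2 M) (X j : MvPolynomial (Fin 3) M))
    (Localization.Away (X j : MvPolynomial (Fin 3) M))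
  have hφ : ∀ y, φ y = y.val := fun y => HomogeneousLocalization.algebraMap_apply y
  refine ⟨D.comp φ, fun c => ?_, fun l => ?_⟩
  · rw [RingHom.comp_apply, hφ, awayC_val, hD]
    simp [e]
  · have h2 : D (φ (awayX j l)) * D (algebraMap (MvPolynomial (Fin 3) M) _ (X j)) =
        D (algebraMap (MvPolynomial (Fin 3) M) _ (X l)) := by
      rw [← map_mul, hφ, awayX, Away.val_mk, Localization.mk_eq_mk'_apply]
      simp only [pow_one]
      rw [IsLocalization.mk'_spec_mk]
    rw [RingHom.comp_apply]
    rw [hD, hD, hej, mul_one] at h2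
    rw [h2]
    simp [e]

theorem exists_away_map (i : K →+* M) (j : Fin 3) :
    ∃ θ : Away (grading 2 K) (X j : MvPolynomial (Fin 3) K) →+*
        Away (grading 2 M) (X j : MvPolynomial (Fin 3) M),
      (∀ c, θ (awayC _ c) = awayC _ (i c)) ∧ (∀ l, θ (awayX j l) = awayX j l) ∧
      Proj.awayι (grading 2 M) (X j) (X_mem_grading M j) Nat.one_pos ≫ planeExt i =
        Spec.map (CommRingCat.ofHom θ) ≫
          Proj.awayι (grading 2 K) (X j) (X_mem_grading K j) Nat.one_pos := by
  -- The chart map naturally lands in the localization at `coeffExt i (X j)`; with `F` a variable,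
  -- the equality with `X j` is used only at the end.
  have key : ∀ (F : MvPolynomial (Fin 3) M) (_ : F = coeffExt i (X j)) (hF : F ∈ grading 2 M 1),
      ∃ θ : Away (grading 2 K) (X j : MvPolynomial (Fin 3) K) →+* Away (grading 2 M) F,
        (∀ c, θ (awayC _ c) = awayC _ (i c)) ∧
        (∀ l, θ (awayX j l) =
          Away.mk (grading 2 M) hF 1 (X l) (by simpa using X_mem_grading M l)) ∧
        Proj.awayι (grading 2 M) F hF Nat.one_pos ≫ planeExt i =
          Spec.map (CommRingCat.ofHom θ) ≫
            Proj.awayι (grading 2 K) (X j) (X_mem_grading K j) Nat.one_pos := by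
    rintro _ rfl hF
    refine ⟨Away.map (coeffExt i) (X j), fun c => ?_, fun l => ?_,
      Proj.awayι_comp_map _ _ Nat.one_pos _ (X_mem_grading K j)⟩
    · rw [awayC_eq_mk (X_mem_grading K j), Away.map_mk]
      refine Eq.trans ?_ (awayC_eq_mk hF (i c)).symm
      congr 1
      exact map_C i c
    · rw [awayX, Away.map_mk]
      congr 1
      exact map_X i l
  exact key (X j) (map_X i j).symm (X_mem_grading M j)

theorem planeExt_preimage_basicOpen (i : K →+* M) (j : Fin 3) :
    planeExt i ⁻¹ᵁ Proj.basicOpen (grading 2 K) (X j) = Proj.basicOpen (grading 2 M) (X j) := by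
  have h : planeExt i ⁻¹ᵁ Proj.basicOpen (grading 2 K) (X j) =
    Proj.basicOpen (grading 2 M) (coeffExt i (X j)) := rfl
  rw [h, coeffExt_apply, map_X]

theorem isPushout_away (i : K →+* M) (j : Fin 3)
    (θ : Away (grading 2 K) (X j : MvPolynomial (Fin 3) K) →+*
      Away (grading 2 M) (X j : MvPolynomial (Fin 3) M))
    (hC : ∀ c, θ (awayC _ c) = awayC _ (i c)) (hX : ∀ l, θ (awayX j l) = awayX j l) :
    IsPushout (CommRingCat.ofHom (awayC (X j : MvPolynomial (Fin 3) K))) (CommRingCat.ofHom i)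
      (CommRingCat.ofHom θ) (CommRingCat.ofHom (awayC (X j : MvPolynomial (Fin 3) M))) := by
  have w : CommRingCat.ofHom (awayC (X j : MvPolynomial (Fin 3) K)) ≫ CommRingCat.ofHom θ =
      CommRingCat.ofHom i ≫ CommRingCat.ofHom (awayC (X j : MvPolynomial (Fin 3) M)) :=
    CommRingCat.hom_ext (RingHom.ext hC)
  refine ⟨⟨w⟩, ⟨Limits.PushoutCocone.IsColimit.mk w (fun s => CommRingCat.ofHom
    (exists_away_desc j s.inl.hom s.inr.hom).choose) ?_ ?_ ?_⟩⟩
  · intro s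
    have h := (exists_away_desc j s.inl.hom s.inr.hom).choose_spec
    refine CommRingCat.hom_ext (away_X_hom_ext j (fun c => ?_) fun l => ?_)
    · refine Eq.trans ?_ (congrArg (fun f => f.hom c) s.condition).symm
      exact (congrArg _ (hC c)).trans (h.1 _)
    · exact (congrArg _ (hX l)).trans (h.2 _)
  · intro s
    have h := (exists_away_desc j s.inl.hom s.inr.hom).choose_spec
    exact CommRingCat.hom_ext (RingHom.ext h.1)
  · intro s m hm hm'
    have h := (exists_away_desc j s.inl.hom s.inr.hom).choose_spec
    refine CommRingCat.hom_ext (away_X_hom_ext j (fun c => ?_) fun l => ?_)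
    · exact (congrArg (fun f => f.hom c) hm').trans (h.1 c).symm
    · refine Eq.trans ?_ (h.2 l).symm
      refine Eq.trans ?_ (congrArg (fun f => f.hom (awayX j l)) hm)
      exact congrArg m.hom (hX l).symm

/-- `ℙ²_M` is the base change of `ℙ²_K`. -/
theorem isPullback_planeExt (i : K →+* M) :
    IsPullback (planeExt i) (planeHom M) (planeHom K) (Spec.map (CommRingCat.ofHom i)) := by
  -- Being a pullback is local on ℙ²_K, and over each standard chart the square is Spec of a pushout
  -- of rings.
  refine Scheme.isPullback_of_openCover _ _ _ _ (standardCover K).openCover fun j => ?_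
  change Fin 3 at j
  obtain ⟨θ, hC, hX, hθ⟩ := exists_away_map i j
  have h1 : IsPullback (Spec.map (CommRingCat.ofHom θ))
      (Proj.awayι (grading 2 M) (X j) (X_mem_grading M j) Nat.one_pos)
      (Proj.awayι (grading 2 K) (X j) (X_mem_grading K j) Nat.one_pos) (planeExt i) := by
    refine IsOpenImmersion.isPullback _ _ _ _ hθ ?_
    rw [Proj.opensRange_awayι, Proj.opensRange_awayι, planeExt_preimage_basicOpen]
  have h2 : IsPullback (Spec.map (CommRingCat.ofHom θ))
      (Proj.awayι (grading 2 M) (X j) (X_mem_grading M j) Nat.one_pos ≫ planeHom M)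
      (Proj.awayι (grading 2 K) (X j) (X_mem_grading K j) Nat.one_pos ≫ planeHom K)
      (Spec.map (CommRingCat.ofHom i)) := by
    rw [awayι_planeHom, awayι_planeHom]
    exact isPullback_SpecMap_of_isPushout _ _ _ _ (isPushout_away i j θ hC hX)
  have h3 : IsPullback (Limits.pullback.snd (planeExt i) ((standardCover K).openCover.f j))
      (Limits.pullback.fst (planeExt i) ((standardCover K).openCover.f j))
      (Proj.awayι (grading 2 K) (X j) (X_mem_grading K j) Nat.one_pos) (planeExt i) :=
    (IsPullback.of_hasPullback _ _).flip
  refine IsPullback.of_iso h2 (h1.isoIsPullback _ _ h3) (Iso.refl _) (Iso.refl _) (Iso.refl _)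
    ?_ ?_ ?_ ?_
  · simp only [Iso.refl_hom]
    exact (h1.isoIsPullback_hom_fst _ _ h3).symm
  · rw [Iso.refl_hom, Category.comp_id]
    refine Eq.trans ?_ (Category.assoc _ _ _)
    exact congrArg (· ≫ planeHom M) (h1.isoIsPullback_hom_snd _ _ h3).symm
  · simp only [Iso.refl_hom, Category.comp_id]
    rfl
  · simp

end Extension

/-! ### Galois actions on the plane and on base changes -/

section Galois

open Matrix.GeneralLinearGroup (scalar)

theorem linearMap_eq_linearMap_iff_scalar {L : Type u} [Field L] {A B : GL (Fin 3) L} :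
    linearMap A = linearMap B ↔ ∃ c : Lˣ, B = scalar (Fin 3) c * A := by
  rw [linearMap_eq_linearMap_iff]
  refine exists_congr fun c => ?_
  rw [← Units.val_inj, Units.val_mul, Matrix.GeneralLinearGroup.coe_scalar, Matrix.scalar_apply,
    Matrix.smul_eq_diagonal_mul]

instance isIso_linearMap {L : Type u} [Field L] (A : GL (Fin 3) L) : IsIso (linearMap A) :=
  ⟨linearMap A⁻¹, by rw [linearMap_comp_linearMap, inv_mul_cancel, linearMap_one],
    by rw [linearMap_comp_linearMap, mul_inv_cancel, linearMap_one]⟩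

theorem galoisPlane_comp_galoisPlane {L : Type u} [Field L] (g h : L ≃+* L) :
    galoisPlane h ≫ galoisPlane g = galoisPlane (h.trans g) := by
  rw [galoisPlane_eq_planeExt, galoisPlane_eq_planeExt, galoisPlane_eq_planeExt]
  exact planeExt_comp_planeExt _ _

theorem galoisPlane_refl {L : Type u} [Field L] : galoisPlane (RingEquiv.refl L) = 𝟙 _ := by
  rw [galoisPlane_eq_planeExt]
  exact planeExt_id

instance isIso_galoisPlane {L : Type u} [Field L] (g : L ≃+* L) : IsIso (galoisPlane g) :=
  ⟨galoisPlane g.symm, by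
    rw [galoisPlane_comp_galoisPlane, RingEquiv.self_trans_symm, galoisPlane_refl], by
    rw [galoisPlane_comp_galoisPlane, RingEquiv.symm_trans_self, galoisPlane_refl]⟩

theorem linearMap_comp_galoisPlane {L : Type u} [Field L] (g : L ≃+* L) (A : GL (Fin 3) L) :
    linearMap A ≫ galoisPlane g =
      galoisPlane g ≫ linearMap (Matrix.GeneralLinearGroup.map (g : L →+* L) A) := by
  rw [galoisPlane_eq_planeExt]
  refine Eq.symm ((planeExt_comp_linearMap _ _).trans ?_)
  have : Matrix.GeneralLinearGroup.map (g.symm : L →+* L)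
      (Matrix.GeneralLinearGroup.map (g : L →+* L) A) = A := by
    ext i j
    simp
  rw [this]
  rfl

theorem galoisPlane_planeHom {L : Type u} [Field L] (g : L ≃+* L) :
    galoisPlane g ≫ (projectivePlane L).hom =
      (projectivePlane L).hom ≫ Spec.map (CommRingCat.ofHom (g.symm : L →+* L)) := by
  rw [galoisPlane_eq_planeExt]
  exact planeExt_planeHom _

variable {k : Type u} [Field k] {S : Over (Spec (CommRingCat.of k))} {L : Type u} [Field L]
  [Algebra k L]

theorem galoisBaseChange_fst (g : L ≃ₐ[k] L) :
    galoisBaseChange S g ≫ Limits.pullback.fst _ _ = Limits.pullback.fst _ _ :=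
  Limits.pullback.lift_fst _ _ _

theorem galoisBaseChange_snd (g : L ≃ₐ[k] L) :
    galoisBaseChange S g ≫ Limits.pullback.snd _ _ =
      Limits.pullback.snd _ _ ≫ Spec.map (CommRingCat.ofHom (g.symm : L →+* L)) :=
  Limits.pullback.lift_snd _ _ _

theorem galoisBaseChange_comp (g h : L ≃ₐ[k] L) :
    galoisBaseChange S h ≫ galoisBaseChange S g = galoisBaseChange S (g * h) := by
  refine Limits.pullback.hom_ext ?_ ?_
  · rw [Category.assoc, galoisBaseChange_fst, galoisBaseChange_fst, galoisBaseChange_fst]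
  · rw [Category.assoc, galoisBaseChange_snd, ← Category.assoc, galoisBaseChange_snd,
      galoisBaseChange_snd, Category.assoc, ← Spec.map_comp]
    rfl

theorem galoisBaseChange_one : galoisBaseChange S (1 : L ≃ₐ[k] L) = 𝟙 _ := by
  refine Limits.pullback.hom_ext ?_ ?_
  · rw [galoisBaseChange_fst]
    exact (Category.id_comp _).symm
  · rw [galoisBaseChange_snd]
    refine Eq.trans ?_ (Category.id_comp _).symm
    exact (congrArg (Limits.pullback.snd _ _ ≫ ·) (Spec.map_id _)).trans (Category.comp_id _)

instance isIso_galoisBaseChange (g : L ≃ₐ[k] L) : IsIso (galoisBaseChange S g) :=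
  ⟨galoisBaseChange S g⁻¹, by rw [galoisBaseChange_comp, inv_mul_cancel, galoisBaseChange_one],
    by rw [galoisBaseChange_comp, mul_inv_cancel, galoisBaseChange_one]⟩

theorem baseChange_map_fst {T : Over (Spec (CommRingCat.of k))} (f : S ⟶ T) :
    ((baseChange k L).map f).left ≫ Limits.pullback.fst _ _ =
      Limits.pullback.fst _ _ ≫ f.left :=
  Limits.pullback.lift_fst _ _ _

theorem baseChange_map_snd {T : Over (Spec (CommRingCat.of k))} (f : S ⟶ T) :
    ((baseChange k L).map f).left ≫ Limits.pullback.snd _ _ = Limits.pullback.snd _ _ :=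
  Limits.pullback.lift_snd _ _ _

theorem baseChange_map_comp_left {T U : Over (Spec (CommRingCat.of k))} (f : S ⟶ T) (f' : T ⟶ U) :
    ((baseChange k L).map (f ≫ f')).left =
      ((baseChange k L).map f).left ≫ ((baseChange k L).map f').left := by
  rw [← Over.comp_left, ← Functor.map_comp]

theorem isIso_baseChange_map_left {T : Over (Spec (CommRingCat.of k))} (e : S ≅ T) :
    IsIso ((baseChange k L).map e.hom).left :=
  ⟨((baseChange k L).map e.inv).left, by
    rw [← baseChange_map_comp_left, Iso.hom_inv_id, CategoryTheory.Functor.map_id, Over.id_left], by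
    rw [← baseChange_map_comp_left, Iso.inv_hom_id, CategoryTheory.Functor.map_id, Over.id_left]⟩

theorem galoisBaseChange_comp_map {T : Over (Spec (CommRingCat.of k))} (f : S ⟶ T)
    (g : L ≃ₐ[k] L) :
    galoisBaseChange S g ≫ ((baseChange k L).map f).left =
      ((baseChange k L).map f).left ≫ galoisBaseChange T g := by
  refine Limits.pullback.hom_ext ?_ ?_
  · rw [Category.assoc, Category.assoc, baseChange_map_fst, galoisBaseChange_fst,
      baseChange_map_fst, ← Category.assoc, galoisBaseChange_fst]
  · rw [Category.assoc, Category.assoc, baseChange_map_snd, galoisBaseChange_snd,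
      galoisBaseChange_snd, ← Category.assoc, baseChange_map_snd]

variable (φ : (baseChange k L).obj S ≅ projectivePlane L)

theorem inv_left_comp_snd : φ.inv.left ≫ Limits.pullback.snd _ _ = (projectivePlane L).hom :=
  Over.w φ.inv

theorem hom_left_comp_hom :
    φ.hom.left ≫ (projectivePlane L).hom =
      Limits.pullback.snd S.hom (Spec.map (CommRingCat.ofHom (algebraMap k L))) :=
  Over.w φ.hom

theorem inv_left_comp_hom_left : φ.inv.left ≫ φ.hom.left = 𝟙 _ := by
  rw [← Over.comp_left, φ.inv_hom_id, Over.id_left]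

theorem hom_left_comp_inv_left : φ.hom.left ≫ φ.inv.left = 𝟙 _ := by
  rw [← Over.comp_left, φ.hom_inv_id, Over.id_left]

instance isIso_hom_left : IsIso φ.hom.left :=
  ⟨φ.inv.left, hom_left_comp_inv_left φ, inv_left_comp_hom_left φ⟩

instance isIso_inv_left : IsIso φ.inv.left :=
  ⟨φ.hom.left, inv_left_comp_hom_left φ, hom_left_comp_inv_left φ⟩

theorem exists_eq_linearMap_of_isIso (f : (projectivePlane L).left ⟶ (projectivePlane L).left)
    (h : IsIso f) (hf : f ≫ (projectivePlane L).hom = (projectivePlane L).hom) :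
    ∃ A : GL (Fin 3) L, f = linearMap A :=
  @exists_eq_linearMap L _ f h hf

end Galois

/-! ### Affine representants -/

section Representants

open Matrix.GeneralLinearGroup (scalar)

variable {k : Type u} [Field k] {S : Over (Spec (CommRingCat.of k))} {L : Type u} [Field L]
  [Algebra k L] (φ : (baseChange k L).obj S ≅ projectivePlane L)

/-- The actions of g on S_L and on ℙ²_L lie over the same automorphism of Spec L. Their discrepancy
is therefore an L-automorphism of the plane, hence a matrix. -/
theorem exists_representsGalois : ∃ B : (L ≃ₐ[k] L) → GL (Fin 3) L, RepresentsGalois φ B := by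
  have key : ∀ g : L ≃ₐ[k] L, ∃ B : GL (Fin 3) L,
      φ.inv.left ≫ galoisBaseChange S g ≫ φ.hom.left =
        galoisPlane (g : L ≃+* L) ≫ linearMap B := by
    intro g
    obtain ⟨B, hB⟩ := exists_eq_linearMap_of_isIso (galoisPlane (g : L ≃+* L).symm ≫ φ.inv.left ≫
      galoisBaseChange S g ≫ φ.hom.left) inferInstance (by
        rw [Category.assoc, Category.assoc, Category.assoc, hom_left_comp_hom φ,
          galoisBaseChange_snd, ← Category.assoc φ.inv.left, inv_left_comp_snd φ, ← Category.assoc,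
          galoisPlane_planeHom, Category.assoc, ← Spec.map_comp, ← CommRingCat.ofHom_comp]
        refine Eq.trans (congrArg (_ ≫ ·) ?_) (Category.comp_id _)
        refine (congrArg Spec.map ?_).trans (Spec.map_id _)
        ext x
        exact (g : L ≃+* L).apply_symm_apply x)
    refine ⟨B, ?_⟩
    rw [← hB]
    rw [← Category.assoc (galoisPlane _) (galoisPlane _), galoisPlane_comp_galoisPlane,
      RingEquiv.self_trans_symm, galoisPlane_refl, Category.id_comp]
  choose B hB using key
  exact ⟨B, hB⟩

theorem exists_represents (α : Aut S) : ∃ A : GL (Fin 3) L, Represents φ α A := by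
  have := isIso_baseChange_map_left (L := L) α
  refine exists_eq_linearMap_of_isIso _ inferInstance ?_
  rw [Category.assoc, Category.assoc, hom_left_comp_hom φ, baseChange_map_snd, inv_left_comp_snd φ]

variable {φ} {B : (L ≃ₐ[k] L) → GL (Fin 3) L}

/-- α_L commutes with the Galois action because α is defined over k; passing from morphisms to
matrices costs one scalar. -/
theorem Represents.exists_comm (hB : RepresentsGalois φ B) {α : Aut S} {A : GL (Fin 3) L}
    (hA : Represents φ α A) (g : L ≃ₐ[k] L) :
    ∃ c : Lˣ, A * B g =
      scalar (Fin 3) c * (B g * Matrix.GeneralLinearGroup.map (g : L →+* L) A) := by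
  rw [← linearMap_eq_linearMap_iff_scalar, ← linearMap_comp_linearMap,
    ← linearMap_comp_linearMap, ← cancel_epi (galoisPlane (g : L ≃+* L)),
    ← Category.assoc, ← Category.assoc, ← hB g]
  refine (congrArg (· ≫ linearMap (B g)) (linearMap_comp_galoisPlane (g : L ≃+* L) A).symm).trans ?_
  simp only [Category.assoc]
  rw [← hB g, ← hA]
  simp only [Category.assoc]
  rw [← Category.assoc φ.hom.left φ.inv.left, hom_left_comp_inv_left, Category.id_comp,
    ← Category.assoc φ.hom.left φ.inv.left, hom_left_comp_inv_left, Category.id_comp,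
    ← Category.assoc (galoisBaseChange S g), galoisBaseChange_comp_map, Category.assoc]

/-- Galois acts on S_L by a group action, which makes B a 1-cocycle up to scalars. -/
theorem RepresentsGalois.exists_mul (hB : RepresentsGalois φ B) (g h : L ≃ₐ[k] L) :
    ∃ c : Lˣ, B (g * h) =
      scalar (Fin 3) c * (B g * Matrix.GeneralLinearGroup.map (g : L →+* L) (B h)) := by
  rw [← linearMap_eq_linearMap_iff_scalar, ← linearMap_comp_linearMap,
    ← cancel_epi (galoisPlane ((g * h : L ≃ₐ[k] L) : L ≃+* L)), ← hB (g * h)]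
  refine (congrArg (· ≫ linearMap (Matrix.GeneralLinearGroup.map (g : L →+* L) (B h)) ≫
    linearMap (B g)) (galoisPlane_comp_galoisPlane (g : L ≃+* L) (h : L ≃+* L)).symm).trans ?_
  rw [Category.assoc, ← Category.assoc (galoisPlane (g : L ≃+* L))]
  refine (congrArg (fun f => galoisPlane (h : L ≃+* L) ≫ f ≫ linearMap (B g))
    (linearMap_comp_galoisPlane (g : L ≃+* L) (B h)).symm).trans ?_
  rw [Category.assoc, ← hB g, ← Category.assoc, ← hB h]
  simp only [Category.assoc]
  rw [← Category.assoc φ.hom.left φ.inv.left, hom_left_comp_inv_left, Category.id_comp,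
    ← Category.assoc (galoisBaseChange S h), galoisBaseChange_comp]

theorem scalar_injective : Function.Injective (scalar (Fin 3) : Lˣ →* GL (Fin 3) L) := by
  intro a b h
  have := congrArg (fun M : GL (Fin 3) L => (M : Matrix (Fin 3) (Fin 3) L) 0 0) h
  simpa [Units.ext_iff] using this

theorem mul_scalar_mul_comm (c : Lˣ) (A B : GL (Fin 3) L) :
    A * (scalar (Fin 3) c * B) = scalar (Fin 3) c * (A * B) := by
  rw [← mul_assoc, ← Matrix.GeneralLinearGroup.scalar_commute, mul_assoc]

theorem isAffineRepresentant_iff {α : Aut S} {A : GL (Fin 3) L} :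
    IsAffineRepresentant φ B α A ↔ Represents φ α A ∧
      ∀ g : L ≃ₐ[k] L, A * B g = B g * Matrix.GeneralLinearGroup.map (g : L →+* L) A := by
  refine and_congr_right fun _ => forall_congr' fun g => ?_
  rw [mul_assoc, eq_inv_mul_iff_mul_eq, eq_comm]

theorem Represents.scalar_mul {α : Aut S} {A : GL (Fin 3) L} (hA : Represents φ α A) (c : Lˣ) :
    Represents φ α (scalar (Fin 3) c * A) :=
  Eq.trans hA (linearMap_eq_linearMap_iff_scalar.2 ⟨c, rfl⟩)

theorem exists_isAffineRepresentant [FiniteDimensional k L] (hB : RepresentsGalois φ B)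
    (α : Aut S) : ∃ A : GL (Fin 3) L, IsAffineRepresentant φ B α A := by
  obtain ⟨A, hA⟩ := exists_represents φ α
  choose c hc using fun g => hA.exists_comm hB g
  -- The scalar by which B fails to be a cocycle occurs on both sides of the computation of A B_{gh}
  -- and drops out.
  have hcoc : groupCohomology.IsMulCocycle₁ c := by
    intro g h
    obtain ⟨l, hl⟩ := hB.exists_mul g h
    have e1 := hc (g * h)
    have hgh : Matrix.GeneralLinearGroup.map ((g * h : L ≃ₐ[k] L) : L →+* L) A =
      Matrix.GeneralLinearGroup.map (g : L →+* L)
        (Matrix.GeneralLinearGroup.map (h : L →+* L) A) := by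
      ext; rfl
    have e2 := congrArg (Matrix.GeneralLinearGroup.map (g : L →+* L)) (hc h)
    rw [map_mul, map_mul, map_mul, Matrix.GeneralLinearGroup.map_scalar] at e2
    have e3 : A * B (g * h) = scalar (Fin 3) (g • c h * c g) *
        (B (g * h) * Matrix.GeneralLinearGroup.map ((g * h : L ≃ₐ[k] L) : L →+* L) A) := by
      rw [hl, mul_scalar_mul_comm, ← mul_assoc A, hc g, mul_assoc (scalar _ (c g)),
        mul_assoc (B g), e2, hgh, mul_scalar_mul_comm, map_mul]
      have : Units.map (((g : L →+* L) : L →* L)) (c h) = g • c h := by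
        ext; rfl
      rw [this, mul_scalar_mul_comm (g • c h)]
      simp only [← mul_assoc, ← map_mul]
      rw [mul_comm (g • c h) (c g), mul_right_comm,
        map_mul (Matrix.GeneralLinearGroup.map _), ← mul_assoc]
    exact scalar_injective (mul_right_cancel (e1.symm.trans e3))
  -- Hilbert 90 gives c g = g • x / x, so rescaling A by x absorbs c g.
  obtain ⟨x, hx⟩ := groupCohomology.isMulCoboundary₁_of_isMulCocycle₁_of_aut_to_units c hcoc
  refine ⟨scalar (Fin 3) x * A, isAffineRepresentant_iff.2 ⟨hA.scalar_mul x, fun g => ?_⟩⟩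
  have : Units.map (((g : L →+* L) : L →* L)) x = g • x := by
    ext; rfl
  rw [map_mul, Matrix.GeneralLinearGroup.map_scalar, this, mul_scalar_mul_comm, mul_assoc,
    hc g, ← mul_assoc, ← map_mul, ← hx g, mul_div_cancel]

/-- Finiteness of L/k is not assumed, since this is also applied over the algebraic closure. -/
theorem exists_algebraMap_units_eq [IsGalois k L] {c : Lˣ} (hc : ∀ g : L ≃ₐ[k] L, g c = c) :
    ∃ d : kˣ, algebraMap k L d = c := by
  obtain ⟨d, hd⟩ := (InfiniteGalois.mem_range_algebraMap_iff_fixed (k := k) (c : L)).2 hc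
  have hd0 : d ≠ 0 := by
    rintro rfl
    exact c.ne_zero (by rw [← hd, map_zero])
  exact ⟨Units.mk0 d hd0, hd⟩

/-- Two representants differ by a scalar of L, and the twisting identity for both makes that scalar
Galois-invariant. -/
theorem IsAffineRepresentant.iff_smul [IsGalois k L] {α : Aut S} {A : GL (Fin 3) L}
    (hA : IsAffineRepresentant φ B α A) (A' : GL (Fin 3) L) :
    IsAffineRepresentant φ B α A' ↔ ∃ c : kˣ,
      A' = scalar (Fin 3) (Units.map (algebraMap k L : k →* L) c) * A := by
  rw [isAffineRepresentant_iff] at hA ⊢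
  constructor
  · rintro ⟨h1, h2⟩
    obtain ⟨c, rfl⟩ := linearMap_eq_linearMap_iff_scalar.1 (hA.1.symm.trans h1)
    obtain ⟨d, hd⟩ := exists_algebraMap_units_eq (k := k) (c := c) fun g => by
      have := h2 g
      rw [map_mul, Matrix.GeneralLinearGroup.map_scalar, mul_assoc, hA.2 g,
        mul_scalar_mul_comm] at this
      exact congrArg Units.val (scalar_injective (mul_right_cancel this)).symm
    exact ⟨d, by rw [show Units.map (algebraMap k L : k →* L) d = c from Units.ext hd]⟩
  · rintro ⟨c, rfl⟩
    refine ⟨hA.1.scalar_mul _, fun g => ?_⟩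
    have : Units.map (((g : L →+* L) : L →* L)) (Units.map (algebraMap k L : k →* L) c) =
        Units.map (algebraMap k L : k →* L) c := by
      ext
      exact g.commutes c
    rw [map_mul, Matrix.GeneralLinearGroup.map_scalar, this, mul_scalar_mul_comm, mul_assoc,
      hA.2 g]

/-- A^g is conjugate to A, so the determinant is fixed by Galois. -/
theorem IsAffineRepresentant.exists_det [IsGalois k L] {α : Aut S} {A : GL (Fin 3) L}
    (hA : IsAffineRepresentant φ B α A) :
    ∃ d : kˣ, algebraMap k L d = (A : Matrix (Fin 3) (Fin 3) L).det := by
  refine exists_algebraMap_units_eq (c := Matrix.GeneralLinearGroup.det A) fun g => ?_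
  have := congrArg Matrix.GeneralLinearGroup.det (hA.2 g)
  rw [Matrix.GeneralLinearGroup.map_det, map_mul, map_mul, map_inv, mul_right_comm,
    inv_mul_cancel, one_mul] at this
  exact congrArg Units.val this

theorem IsAffineRepresentant.mul {α β : Aut S} {A C : GL (Fin 3) L}
    (hA : IsAffineRepresentant φ B α A) (hC : IsAffineRepresentant φ B β C) :
    IsAffineRepresentant φ B (α * β) (A * C) := by
  refine ⟨?_, fun g => ?_⟩
  · refine Eq.trans ?_ (linearMap_comp_linearMap C A)
    rw [← hA.1, ← hC.1]
    simp only [Category.assoc]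
    rw [← Category.assoc φ.hom.left φ.inv.left, hom_left_comp_inv_left, Category.id_comp,
      ← Category.assoc ((baseChange k L).map β.hom).left]
    exact congrArg (φ.inv.left ≫ · ≫ φ.hom.left) (baseChange_map_comp_left β.hom α.hom)
  · rw [map_mul, hA.2 g, hC.2 g]
    group

/-- The determinants of the affine representants for two splittings over the same field agree up
to cubes. -/
theorem IsAffineRepresentant.exists_det_eq [IsGalois k L]
    {φ' : (baseChange k L).obj S ≅ projectivePlane L} {B' : (L ≃ₐ[k] L) → GL (Fin 3) L}
    (hB : RepresentsGalois φ B) (hB' : RepresentsGalois φ' B') {α : Aut S} {A A' : GL (Fin 3) L}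
    (hA : IsAffineRepresentant φ B α A) (hA' : IsAffineRepresentant φ' B' α A') :
    ∃ c : kˣ, (A' : Matrix (Fin 3) (Fin 3) L).det =
      algebraMap k L c ^ 3 * (A : Matrix (Fin 3) (Fin 3) L).det := by
  obtain ⟨C, hC⟩ : ∃ C : GL (Fin 3) L, φ.inv.left ≫ φ'.hom.left = linearMap C := by
    refine exists_eq_linearMap_of_isIso _ inferInstance ?_
    rw [Category.assoc, hom_left_comp_hom φ', inv_left_comp_snd φ]
  have hinv : φ'.inv.left ≫ φ.hom.left = linearMap C⁻¹ := by
    rw [← cancel_mono (linearMap C), linearMap_comp_linearMap, mul_inv_cancel, linearMap_one, ← hC,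
      Category.assoc, ← Category.assoc φ.hom.left, hom_left_comp_inv_left, Category.id_comp,
      inv_left_comp_hom_left]
  have h1 : Represents φ' α (C * A * C⁻¹) := by
    refine Eq.trans ?_ ((linearMap_comp_linearMap C⁻¹ (C * A)).trans (by rw [mul_assoc]))
    rw [← linearMap_comp_linearMap, ← hC, ← hinv, ← hA.1]
    simp only [Category.assoc]
    rw [← Category.assoc φ.hom.left φ.inv.left, hom_left_comp_inv_left, Category.id_comp,
      ← Category.assoc φ.hom.left φ.inv.left, hom_left_comp_inv_left, Category.id_comp]
  -- Changing φ by C replaces B_g by the twisted conjugate C B_g (C⁻¹)^g. The extra scalar l cancels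
  -- in the condition on C A C⁻¹.
  have h2 : ∀ g : L ≃ₐ[k] L, ∃ l : Lˣ, B' g = scalar (Fin 3) l *
      (C * B g * Matrix.GeneralLinearGroup.map (g : L →+* L) C⁻¹) := by
    intro g
    rw [← linearMap_eq_linearMap_iff_scalar, ← linearMap_comp_linearMap,
      ← cancel_epi (galoisPlane (g : L ≃+* L)), ← hB' g, ← Category.assoc]
    refine (congrArg (· ≫ linearMap (C * B g))
      (linearMap_comp_galoisPlane (g : L ≃+* L) C⁻¹).symm).trans ?_
    rw [Category.assoc, ← linearMap_comp_linearMap, ← Category.assoc (galoisPlane _), ← hB g,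
      ← hC, ← hinv]
    simp only [Category.assoc]
    rw [← Category.assoc φ.hom.left φ.inv.left, hom_left_comp_inv_left, Category.id_comp,
      ← Category.assoc φ.hom.left φ.inv.left, hom_left_comp_inv_left, Category.id_comp]
  have h3 : IsAffineRepresentant φ' B' α (C * A * C⁻¹) := by
    refine isAffineRepresentant_iff.2 ⟨h1, fun g => ?_⟩
    obtain ⟨l, hl⟩ := h2 g
    rw [hl, mul_scalar_mul_comm, mul_assoc (scalar _ l)]
    congr 1
    rw [map_mul, map_mul, hA.2 g, map_inv]
    group
  obtain ⟨c, rfl⟩ := (h3.iff_smul A').1 hA'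
  refine ⟨c, ?_⟩
  have := congrArg Units.val (Matrix.GeneralLinearGroup.det.map_mul
    (scalar (Fin 3) (Units.map (algebraMap k L : k →* L) c)) (C * A * C⁻¹))
  rw [Matrix.GeneralLinearGroup.det_scalar, map_mul _ (C * A), map_mul _ C A,
    map_inv, mul_inv_cancel_comm] at this
  exact this

end Representants

/-! ### Change of the splitting field -/

section Transport

/-- The projection `ℙ²_M ⟶ ℙ²_K` induced by `K → M`, on the underlying schemes of the planes. -/
noncomputable def planeProj {K M : Type u} [Field K] [Field M] (i : K →+* M) :
    (projectivePlane M).left ⟶ (projectivePlane K).left :=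
  planeExt i

theorem isPullback_planeProj {K M : Type u} [Field K] [Field M] (i : K →+* M) :
    IsPullback (planeProj i) (projectivePlane M).hom (projectivePlane K).hom
      (Spec.map (CommRingCat.ofHom i)) :=
  isPullback_planeExt i

theorem linearMap_comp_planeProj {K M : Type u} [Field K] [Field M] (i : K →+* M)
    (A : GL (Fin 3) K) :
    linearMap (Matrix.GeneralLinearGroup.map i A) ≫ planeProj i = planeProj i ≫ linearMap A :=
  (planeExt_comp_linearMap i A).symm

theorem galoisPlane_comp_planeProj {K M : Type u} [Field K] [Field M] (i : K →+* M)
    (g : M ≃+* M) (h : K ≃+* K) (hi : ∀ x, i (h x) = g (i x)) :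
    galoisPlane g ≫ planeProj i = planeProj i ≫ galoisPlane h := by
  rw [galoisPlane_eq_planeExt, galoisPlane_eq_planeExt]
  refine (planeExt_comp_planeExt _ _).trans (Eq.trans ?_ (planeExt_comp_planeExt _ _).symm)
  congr 1
  ext x
  refine g.injective ((g.apply_symm_apply _).trans ?_)
  exact (congrArg i (h.apply_symm_apply x)).symm.trans (hi _)

theorem linearMap_comp_hom {K : Type u} [Field K] (A : GL (Fin 3) K) :
    linearMap A ≫ (projectivePlane K).hom = (projectivePlane K).hom :=
  linearMap_planeHom A

variable {k : Type u} [Field k] {S : Over (Spec (CommRingCat.of k))} {L M : Type u} [Field L]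
  [Algebra k L] [Field M] [Algebra k M] [Algebra L M] [IsScalarTower k L M]

theorem specMap_comp_specMap_algebraMap :
    Spec.map (CommRingCat.ofHom (algebraMap L M)) ≫ Spec.map (CommRingCat.ofHom (algebraMap k L)) =
      Spec.map (CommRingCat.ofHom (algebraMap k M)) := by
  rw [← Spec.map_comp, ← CommRingCat.ofHom_comp, ← IsScalarTower.algebraMap_eq]

variable (S L M) in
/-- The projection `S_M ⟶ S_L`. -/
noncomputable def baseChangeProj :
    ((baseChange k M).obj S).left ⟶ ((baseChange k L).obj S).left :=
  Limits.pullback.lift (Limits.pullback.fst _ _)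
    (Limits.pullback.snd _ _ ≫ Spec.map (CommRingCat.ofHom (algebraMap L M))) (by
      rw [Category.assoc, specMap_comp_specMap_algebraMap, Limits.pullback.condition])

theorem baseChangeProj_fst :
    baseChangeProj S L M ≫ Limits.pullback.fst _ _ = Limits.pullback.fst _ _ :=
  Limits.pullback.lift_fst _ _ _

theorem baseChangeProj_snd :
    baseChangeProj S L M ≫ Limits.pullback.snd _ _ =
      Limits.pullback.snd _ _ ≫ Spec.map (CommRingCat.ofHom (algebraMap L M)) :=
  Limits.pullback.lift_snd _ _ _

variable (S L M) in
theorem isPullback_baseChangeProj :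
    IsPullback (baseChangeProj S L M) ((baseChange k M).obj S).hom ((baseChange k L).obj S).hom
      (Spec.map (CommRingCat.ofHom (algebraMap L M))) := by
  refine IsPullback.of_right (h₁₂ := Limits.pullback.fst S.hom _) (v₁₃ := S.hom)
    (h₂₂ := Spec.map (CommRingCat.ofHom (algebraMap k L))) ?_ baseChangeProj_snd
    (IsPullback.of_hasPullback _ _)
  rw [baseChangeProj_fst, specMap_comp_specMap_algebraMap]
  exact IsPullback.of_hasPullback _ _

theorem baseChange_map_comp_baseChangeProj {T : Over (Spec (CommRingCat.of k))} (f : S ⟶ T) :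
    ((baseChange k M).map f).left ≫ baseChangeProj T L M =
      baseChangeProj S L M ≫ ((baseChange k L).map f).left := by
  refine Limits.pullback.hom_ext ?_ ?_
  · rw [Category.assoc, Category.assoc, baseChange_map_fst, baseChangeProj_fst, baseChange_map_fst,
      ← Category.assoc, baseChangeProj_fst]
  · rw [Category.assoc, Category.assoc, baseChange_map_snd, baseChangeProj_snd, baseChangeProj_snd,
      ← Category.assoc, baseChange_map_snd]

theorem galoisBaseChange_comp_baseChangeProj [Normal k L] (g : M ≃ₐ[k] M) :
    galoisBaseChange S g ≫ baseChangeProj S L M =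
      baseChangeProj S L M ≫ galoisBaseChange S (g.restrictNormal L) := by
  refine Limits.pullback.hom_ext ?_ ?_
  · rw [Category.assoc, Category.assoc, galoisBaseChange_fst, baseChangeProj_fst,
      galoisBaseChange_fst]
  · rw [Category.assoc, Category.assoc, galoisBaseChange_snd, baseChangeProj_snd, ← Category.assoc,
      galoisBaseChange_snd, ← Category.assoc, baseChangeProj_snd, Category.assoc, Category.assoc,
      ← Spec.map_comp, ← Spec.map_comp]
    congr 2
    ext x
    refine g.injective ((g.apply_symm_apply _).trans ?_)
    refine Eq.trans ?_ (g.restrictNormal_commutes L _)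
    exact (congrArg (algebraMap L M) ((g.restrictNormal L).apply_symm_apply x)).symm

/-- S_M and ℙ²_M are both pullbacks along Spec M → Spec L, so φ induces φ'. The two projection
identities are what transports matrices from L to M. -/
theorem exists_iso_baseChange (φ : (baseChange k L).obj S ≅ projectivePlane L) :
    ∃ φ' : (baseChange k M).obj S ≅ projectivePlane M,
      φ'.hom.left ≫ planeProj (algebraMap L M) = baseChangeProj S L M ≫ φ.hom.left ∧
      φ'.inv.left ≫ baseChangeProj S L M = planeProj (algebraMap L M) ≫ φ.inv.left := by
  have hP := isPullback_planeProj (algebraMap L M)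
  have hX := isPullback_baseChangeProj S L M
  let a := hP.lift (baseChangeProj S L M ≫ φ.hom.left) ((baseChange k M).obj S).hom
    (by rw [Category.assoc, Over.w, hX.w])
  let b := hX.lift (planeProj (algebraMap L M) ≫ φ.inv.left) (projectivePlane M).hom
    (by rw [Category.assoc, Over.w, hP.w])
  have ha : a ≫ planeProj (algebraMap L M) = baseChangeProj S L M ≫ φ.hom.left :=
    hP.lift_fst _ _ _
  have ha' : a ≫ (projectivePlane M).hom = ((baseChange k M).obj S).hom := hP.lift_snd _ _ _
  have hb : b ≫ baseChangeProj S L M = planeProj (algebraMap L M) ≫ φ.inv.left :=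
    hX.lift_fst _ _ _
  have hb' : b ≫ ((baseChange k M).obj S).hom = (projectivePlane M).hom := hX.lift_snd _ _ _
  refine ⟨Over.isoMk ⟨a, b, hX.hom_ext ?_ ?_, hP.hom_ext ?_ ?_⟩ ha', ha, hb⟩
  · rw [Category.assoc, hb, ← Category.assoc, ha, Category.assoc, hom_left_comp_inv_left,
      Category.comp_id, Category.id_comp]
  · rw [Category.assoc, hb', ha', Category.id_comp]
  · rw [Category.assoc, ha, ← Category.assoc, hb, Category.assoc, inv_left_comp_hom_left,
      Category.comp_id, Category.id_comp]
  · rw [Category.assoc, ha', hb', Category.id_comp]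

variable {φ : (baseChange k L).obj S ≅ projectivePlane L}
  {φ' : (baseChange k M).obj S ≅ projectivePlane M}

/-- Morphisms into ℙ²_M are compared after projection to ℙ²_L and to Spec M. On objects over L, g
acts through its restriction to L, which exists by normality. -/
theorem RepresentsGalois.of_tower [Normal k L]
    (h : φ'.hom.left ≫ planeProj (algebraMap L M) = baseChangeProj S L M ≫ φ.hom.left)
    (h' : φ'.inv.left ≫ baseChangeProj S L M = planeProj (algebraMap L M) ≫ φ.inv.left)
    {B : (L ≃ₐ[k] L) → GL (Fin 3) L} (hB : RepresentsGalois φ B) :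
    RepresentsGalois φ' fun g =>
      Matrix.GeneralLinearGroup.map (algebraMap L M) (B (g.restrictNormal L)) := by
  intro g
  refine (isPullback_planeProj (algebraMap L M)).hom_ext ?_ ?_
  · rw [Category.assoc, Category.assoc, Category.assoc, h, linearMap_comp_planeProj,
      ← Category.assoc (galoisBaseChange S g), galoisBaseChange_comp_baseChangeProj, Category.assoc,
      ← Category.assoc φ'.inv.left, h', Category.assoc, hB, ← Category.assoc, ← Category.assoc,
      galoisPlane_comp_planeProj (algebraMap L M) (g : M ≃+* M) (g.restrictNormal L : L ≃+* L)
        fun x => g.restrictNormal_commutes L x]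
  · rw [Category.assoc, Category.assoc, Category.assoc, linearMap_comp_hom, galoisPlane_planeHom,
      hom_left_comp_hom, galoisBaseChange_snd, ← Category.assoc φ'.inv.left, inv_left_comp_snd]
    rfl

theorem Represents.of_tower
    (h : φ'.hom.left ≫ planeProj (algebraMap L M) = baseChangeProj S L M ≫ φ.hom.left)
    (h' : φ'.inv.left ≫ baseChangeProj S L M = planeProj (algebraMap L M) ≫ φ.inv.left)
    {α : Aut S} {A : GL (Fin 3) L} (hA : Represents φ α A) :
    Represents φ' α (Matrix.GeneralLinearGroup.map (algebraMap L M) A) := by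
  refine (isPullback_planeProj (algebraMap L M)).hom_ext ?_ ?_
  · rw [linearMap_comp_planeProj, Category.assoc, Category.assoc, h,
      ← Category.assoc ((baseChange k M).map α.hom).left, baseChange_map_comp_baseChangeProj,
      Category.assoc, ← Category.assoc φ'.inv.left, h', Category.assoc, hA]
  · rw [Category.assoc, Category.assoc, linearMap_comp_hom, hom_left_comp_hom, baseChange_map_snd,
      inv_left_comp_snd]

theorem IsAffineRepresentant.of_tower [Normal k L]
    (h : φ'.hom.left ≫ planeProj (algebraMap L M) = baseChangeProj S L M ≫ φ.hom.left)
    (h' : φ'.inv.left ≫ baseChangeProj S L M = planeProj (algebraMap L M) ≫ φ.inv.left)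
    {B : (L ≃ₐ[k] L) → GL (Fin 3) L} {α : Aut S} {A : GL (Fin 3) L}
    (hA : IsAffineRepresentant φ B α A) :
    IsAffineRepresentant φ' (fun g =>
      Matrix.GeneralLinearGroup.map (algebraMap L M) (B (g.restrictNormal L))) α
      (Matrix.GeneralLinearGroup.map (algebraMap L M) A) := by
  refine ⟨hA.1.of_tower h h', fun g => ?_⟩
  have : Matrix.GeneralLinearGroup.map (g : M →+* M)
      (Matrix.GeneralLinearGroup.map (algebraMap L M) A) =
      Matrix.GeneralLinearGroup.map (algebraMap L M)
        (Matrix.GeneralLinearGroup.map ((g.restrictNormal L : L ≃ₐ[k] L) : L →+* L) A) := by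
    ext i j
    exact (g.restrictNormal_commutes L _).symm
  rw [this, hA.2, map_mul, map_mul, map_inv]

end Transport

/-! ### The determinant -/

section Determinant

variable {k : Type u} [Field k] [PerfectField k] {S : Over (Spec (CommRingCat.of k))}

theorem isGalois_algebraicClosure : IsGalois k (AlgebraicClosure k) := by
  constructor

/-- Embed L and L' in the algebraic closure and move both representants there. Their determinants
differ by the cube of an element of k*, and this relation descends because k → k̄ is injective. -/
theorem mk_det_eq_mk_det {L L' : Type u} [Field L] [Algebra k L] [FiniteDimensional k L]
    [IsGalois k L] [Field L'] [Algebra k L'] [FiniteDimensional k L'] [IsGalois k L']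
    {φ : (baseChange k L).obj S ≅ projectivePlane L} {B : (L ≃ₐ[k] L) → GL (Fin 3) L}
    {φ' : (baseChange k L').obj S ≅ projectivePlane L'} {B' : (L' ≃ₐ[k] L') → GL (Fin 3) L'}
    (hB : RepresentsGalois φ B) (hB' : RepresentsGalois φ' B') {α : Aut S}
    {A : GL (Fin 3) L} {A' : GL (Fin 3) L'} (hA : IsAffineRepresentant φ B α A)
    (hA' : IsAffineRepresentant φ' B' α A') {d d' : kˣ}
    (hd : algebraMap k L d = (A : Matrix (Fin 3) (Fin 3) L).det)
    (hd' : algebraMap k L' d' = (A' : Matrix (Fin 3) (Fin 3) L').det) :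
    (QuotientGroup.mk d : UnitsModCubes k) = QuotientGroup.mk d' := by
  let M := AlgebraicClosure k
  have : IsGalois k M := isGalois_algebraicClosure
  let i : L →ₐ[k] M := IsAlgClosed.lift
  let i' : L' →ₐ[k] M := IsAlgClosed.lift
  let := i.toAlgebra
  let := i'.toAlgebra
  have : IsScalarTower k L M := IsScalarTower.of_algHom i
  have : IsScalarTower k L' M := IsScalarTower.of_algHom i'
  obtain ⟨ψ, h1, h2⟩ := exists_iso_baseChange (M := M) φ
  obtain ⟨ψ', h1', h2'⟩ := exists_iso_baseChange (M := M) φ'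
  obtain ⟨c, hc⟩ := (hA.of_tower h1 h2).exists_det_eq (hB.of_tower h1 h2) (hB'.of_tower h1' h2')
    (hA'.of_tower h1' h2')
  have e : algebraMap L M (algebraMap k L d) =
      ((Matrix.GeneralLinearGroup.map (algebraMap L M) A : GL (Fin 3) M) :
        Matrix (Fin 3) (Fin 3) M).det := by
    rw [hd]
    exact RingHom.map_det _ _
  have e' : algebraMap L' M (algebraMap k L' d') =
      ((Matrix.GeneralLinearGroup.map (algebraMap L' M) A' : GL (Fin 3) M) :
        Matrix (Fin 3) (Fin 3) M).det := by
    rw [hd']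
    exact RingHom.map_det _ _
  rw [← e, ← e', ← IsScalarTower.algebraMap_apply, ← IsScalarTower.algebraMap_apply, ← map_pow,
    ← map_mul] at hc
  have hcd := (algebraMap k M).injective hc
  refine QuotientGroup.eq.2 ⟨c, ?_⟩
  rw [eq_inv_mul_iff_mul_eq]
  ext
  simpa [mul_comm] using hcd.symm

theorem existsUnique_det {L₀ : Type u} [Field L₀] [Algebra k L₀] [FiniteDimensional k L₀]
    [IsGalois k L₀] (φ₀ : (baseChange k L₀).obj S ≅ projectivePlane L₀) :
    ∃! det : Aut S →* UnitsModCubes k,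
      ∀ (L : Type u) [Field L] [Algebra k L] [FiniteDimensional k L] [IsGalois k L]
        (φ : (baseChange k L).obj S ≅ projectivePlane L)
        (B : (L ≃ₐ[k] L) → GL (Fin 3) L), RepresentsGalois φ B →
        ∀ (α : Aut S) (A : GL (Fin 3) L), IsAffineRepresentant φ B α A →
          ∃ d : kˣ, algebraMap k L d = (A : Matrix (Fin 3) (Fin 3) L).det ∧
            det α = QuotientGroup.mk d := by
  obtain ⟨B₀, hB₀⟩ := exists_representsGalois φ₀
  choose A₀ hA₀ using exists_isAffineRepresentant hB₀
  choose d₀ hd₀ using fun α => (hA₀ α).exists_det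
  -- The map is defined through one fixed splitting; comparison of determinants then gives
  -- multiplicativity, independence and uniqueness.
  refine ⟨MonoidHom.mk' (fun α => QuotientGroup.mk (d₀ α)) fun α β => ?_, ?_, ?_⟩
  · rw [← QuotientGroup.mk_mul]
    refine mk_det_eq_mk_det hB₀ hB₀ (hA₀ (α * β)) ((hA₀ α).mul (hA₀ β)) (hd₀ _) ?_
    rw [Units.val_mul, map_mul, hd₀, hd₀, Units.val_mul, Matrix.det_mul]
  · intro L _ _ _ _ φ B hB α A hA
    obtain ⟨d, hd⟩ := hA.exists_det
    exact ⟨d, hd, mk_det_eq_mk_det hB₀ hB (hA₀ α) hA (hd₀ α) hd⟩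
  · intro f hf
    ext α
    obtain ⟨d, hd, hfd⟩ := hf L₀ φ₀ B₀ hB₀ α (A₀ α) (hA₀ α)
    exact hfd.trans (mk_det_eq_mk_det hB₀ hB₀ (hA₀ α) (hA₀ α) hd (hd₀ α))

end Determinant

/-! ### Existence of a finite Galois splitting field -/

section Splitting

variable (k M : Type u) [Field k] [Field M] [Algebra k M]

/-- The diagram of the finite Galois subextensions of `M/k`. -/
noncomputable def finiteGaloisDiagram : FiniteGaloisIntermediateField k M ⥤ CommRingCat.{u} where
  obj F := CommRingCat.of F
  map f := CommRingCat.ofHom (IntermediateField.inclusion (leOfHom f)).toRingHom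
  map_id _ := rfl
  map_comp _ _ := rfl

variable {k M} in
-- Each x lies in the finite Galois extension generated by it, which prescribes its image. Any two
-- elements share such an extension, where sums and products can be checked.
theorem exists_ringHom_of_compatible [IsGalois k M] {T : Type*} [CommRing T]
    (f : ∀ F : FiniteGaloisIntermediateField k M, F →+* T)
    (hf : ∀ (F F' : FiniteGaloisIntermediateField k M) (h : F ≤ F') (x : F),
      f F' (IntermediateField.inclusion h x) = f F x) :
    ∃ d : M →+* T, ∀ (F : FiniteGaloisIntermediateField k M) (x : F), d x = f F x := by
  have mem : ∀ x : M, x ∈ (FiniteGaloisIntermediateField.adjoin k {x}).toIntermediateField :=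
    fun x => FiniteGaloisIntermediateField.subset_adjoin k {x} rfl
  have hle : ∀ (F : FiniteGaloisIntermediateField k M) (x : F),
      FiniteGaloisIntermediateField.adjoin k {(x : M)} ≤ F := fun F x =>
    FiniteGaloisIntermediateField.adjoin_simple_le_iff.2 x.2
  have key : ∀ (F : FiniteGaloisIntermediateField k M) (x : F),
      f (FiniteGaloisIntermediateField.adjoin k {(x : M)}) ⟨x, mem x⟩ = f F x :=
    fun F x => (hf _ F (hle F x) ⟨x, mem x⟩).symm
  have pair : ∀ x y : M, ∃ (F : FiniteGaloisIntermediateField k M) (a b : F),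
      (a : M) = x ∧ (b : M) = y := fun x y =>
    ⟨FiniteGaloisIntermediateField.adjoin k {x, y},
      ⟨x, FiniteGaloisIntermediateField.subset_adjoin k _ (Set.mem_insert _ _)⟩,
      ⟨y, FiniteGaloisIntermediateField.subset_adjoin k _ (Set.mem_insert_of_mem _ rfl)⟩, rfl, rfl⟩
  refine ⟨{
    toFun := fun x => f (FiniteGaloisIntermediateField.adjoin k {x}) ⟨x, mem x⟩
    map_zero' := (key ⊥ 0).trans (map_zero _)
    map_one' := (key ⊥ 1).trans (map_one _)
    map_add' := fun x y => by
      obtain ⟨F, a, b, rfl, rfl⟩ := pair x y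
      rw [key F a, key F b, ← map_add]
      exact key F (a + b)
    map_mul' := fun x y => by
      obtain ⟨F, a, b, rfl, rfl⟩ := pair x y
      rw [key F a, key F b, ← map_mul]
      exact key F (a * b) }, key⟩

/-- A Galois extension of `k` as a cocone over its finite Galois subextensions. -/
noncomputable def finiteGaloisCocone : Limits.Cocone (finiteGaloisDiagram k M) where
  pt := CommRingCat.of M
  ι := { app := fun F => CommRingCat.ofHom (algebraMap F M), naturality := fun _ _ _ => rfl }

/-- A Galois extension is the colimit of its finite Galois subextensions. -/
noncomputable def isColimitFiniteGaloisCocone [IsGalois k M] :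
    Limits.IsColimit (finiteGaloisCocone k M) := by
  have h : ∀ s : Limits.Cocone (finiteGaloisDiagram k M), ∃ d : M →+* s.pt,
      ∀ (F : FiniteGaloisIntermediateField k M) (x : F), d x = (s.ι.app F).hom x := fun s =>
    exists_ringHom_of_compatible (k := k) (M := M) (T := s.pt)
      (fun F => (s.ι.app F).hom) fun _ _ h x => congrArg (fun q => q.hom x) (s.w (homOfLE h))
  refine
    { desc := fun s => CommRingCat.ofHom (h s).choose
      fac := fun s F => CommRingCat.hom_ext (RingHom.ext fun x => (h s).choose_spec F x)
      uniq := fun s m hm => CommRingCat.hom_ext (RingHom.ext fun x => ?_) }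
  change M at x
  have hx : x ∈ (FiniteGaloisIntermediateField.adjoin k {x}).toIntermediateField :=
    FiniteGaloisIntermediateField.subset_adjoin k {x} rfl
  refine Eq.trans ?_ ((h s).choose_spec (FiniteGaloisIntermediateField.adjoin k {x}) ⟨x, hx⟩).symm
  exact congrArg (fun q => q.hom ⟨x, hx⟩) (hm (FiniteGaloisIntermediateField.adjoin k {x}))

/-- The diagram of the projective planes over the finite Galois subextensions of `M/k`. -/
noncomputable def planeDiagram : (FiniteGaloisIntermediateField k M)ᵒᵖ ⥤ Scheme.{u} where
  obj F := Proj (grading 2 F.unop)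
  map f := planeExt (IntermediateField.inclusion (leOfHom f.unop)).toRingHom
  map_id _ := planeExt_id
  map_comp f g := (planeExt_comp_planeExt
    (IntermediateField.inclusion (leOfHom g.unop)).toRingHom
    (IntermediateField.inclusion (leOfHom f.unop)).toRingHom).symm

/-- The projection from `planeDiagram` to the spectra of the fields. -/
noncomputable def planeDiagramHom :
    planeDiagram k M ⟶ (finiteGaloisDiagram k M).op ⋙ Scheme.Spec where
  app F := planeHom F.unop
  naturality _ _ _ := planeExt_planeHom _

/-- `ℙ²_M` as a cone over the planes over the finite Galois subextensions of `M/k`. -/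
noncomputable def planeCone : Limits.Cone (planeDiagram k M) where
  pt := Proj (grading 2 M)
  π :=
    { app := fun F => planeExt (algebraMap F.unop M)
      naturality := fun F _ f => (Category.id_comp _).trans
        (planeExt_comp_planeExt (IntermediateField.inclusion (leOfHom f.unop)).toRingHom
          (algebraMap F.unop M)).symm }

/-- `ℙ²_M` is the limit of the planes over the finite Galois subextensions of `M/k`. -/
noncomputable def isLimitPlaneCone [IsGalois k M] : Limits.IsLimit (planeCone k M) := by
  -- All planes are base changes of the plane over ⊥. A cone thus amounts to a map to that plane and
  -- a compatible family of maps to the spectra, whose limit is Spec M.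
  let hc := Limits.isLimitOfPreserves Scheme.Spec (isColimitFiniteGaloisCocone k M).op
  let q := fun s : Limits.Cone (planeDiagram k M) =>
    hc.lift ((Limits.Cone.postcompose (planeDiagramHom k M)).obj s)
  have hq : ∀ (s : Limits.Cone (planeDiagram k M)) (F : FiniteGaloisIntermediateField k M),
      q s ≫ Spec.map (CommRingCat.ofHom (algebraMap F M)) = s.π.app (.op F) ≫ planeHom F :=
    fun s F => hc.fac _ (.op F)
  have w : ∀ s : Limits.Cone (planeDiagram k M),
      s.π.app (.op ⊥) ≫ planeHom (⊥ : FiniteGaloisIntermediateField k M) =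
        q s ≫ Spec.map (CommRingCat.ofHom
          (algebraMap (⊥ : FiniteGaloisIntermediateField k M) M)) := fun s => (hq s ⊥).symm
  have hP := isPullback_planeExt (algebraMap (⊥ : FiniteGaloisIntermediateField k M) M)
  refine
    { lift := fun s => hP.lift (s.π.app (.op ⊥)) (q s) (w s)
      fac := fun s F => ?_
      uniq := fun s m hm => hP.hom_ext ?_ ?_ }
  · have hF := isPullback_planeExt (IntermediateField.inclusion
      (bot_le : (⊥ : FiniteGaloisIntermediateField k M) ≤ F.unop)).toRingHom
    refine hF.hom_ext ?_ ?_
    · refine (Category.assoc _ _ _).trans ?_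
      refine Eq.trans ?_ (s.w (homOfLE (bot_le : ⊥ ≤ F.unop)).op).symm
      exact (congrArg _ (planeExt_comp_planeExt _ _)).trans (hP.lift_fst _ _ (w s))
    · refine (Category.assoc _ _ _).trans ?_
      refine (congrArg _ (planeExt_planeHom (algebraMap F.unop M))).trans ?_
      refine (Category.assoc _ _ _).symm.trans ?_
      exact (congrArg (· ≫ _) (hP.lift_snd _ _ (w s))).trans (hq s F.unop)
  · exact (hm (.op ⊥)).trans (hP.lift_fst _ _ (w s)).symm
  · refine Eq.trans ?_ (hP.lift_snd _ _ (w s)).symm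
    refine hc.hom_ext fun F => ?_
    refine Eq.trans ?_ (hc.fac ((Limits.Cone.postcompose (planeDiagramHom k M)).obj s) F).symm
    refine Eq.trans ?_ (congrArg (· ≫ planeHom F.unop) (hm F))
    refine (Category.assoc _ _ _).trans (Eq.trans ?_ (Category.assoc _ _ _).symm)
    exact congrArg (m ≫ ·) (planeExt_planeHom (algebraMap F.unop M)).symm

theorem compactSpace_plane (K : Type u) [Field K] : CompactSpace (Proj (grading 2 K)) := by
  have : Finite (standardCover K).openCover.I₀ := inferInstanceAs (Finite (Fin 3))
  have : ∀ i, CompactSpace ((standardCover K).openCover.X i) := fun i =>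
    inferInstanceAs (CompactSpace (Spec _))
  exact Scheme.OpenCover.compactSpace (standardCover K).openCover

theorem isAffineHom_planeExt {K K' : Type u} [Field K] [Field K'] (i : K →+* K') :
    IsAffineHom (planeExt i) :=
  MorphismProperty.of_isPullback (P := @IsAffineHom) (isPullback_planeExt i).flip inferInstance

variable {k M} in
-- Spec M → Spec L is flat, surjective and quasi-compact, hence so is its base change q, and being
-- an isomorphism descends along such morphisms.
theorem isIso_of_isIso_baseChange {L : Type u} [Field L] [Algebra L M] {X Y X' Y' : Scheme.{u}}
    {f : X ⟶ Y} {f' : X' ⟶ Y'} {p : X' ⟶ X} {q : Y' ⟶ Y} (y : Y ⟶ Spec (CommRingCat.of L))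
    (y' : Y' ⟶ Spec (CommRingCat.of M)) (h : IsPullback p f' f q)
    (hq : IsPullback q y' y (Spec.map (CommRingCat.ofHom (algebraMap L M)))) (hf : IsIso f') :
    IsIso f := by
  have hS : (@Surjective ⊓ @Flat ⊓ @QuasiCompact : MorphismProperty Scheme.{u})
      (Spec.map (CommRingCat.ofHom (algebraMap L M))) := by
    have : (CommRingCat.ofHom (algebraMap L M)).hom.FaithfullyFlat := by
      rw [CommRingCat.hom_ofHom, RingHom.faithfullyFlat_algebraMap_iff]
      infer_instance
    obtain ⟨h1, h2⟩ := flat_and_surjective_SpecMap_iff _ |>.2 this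
    exact ⟨⟨h2, h1⟩, (inferInstance : QuasiCompact _)⟩
  have hq' : (@Surjective ⊓ @Flat ⊓ @QuasiCompact : MorphismProperty Scheme.{u}) q :=
    ⟨⟨MorphismProperty.of_isPullback (P := @Surjective) hq.flip hS.1.1,
      MorphismProperty.of_isPullback (P := @Flat) hq.flip hS.1.2⟩,
      MorphismProperty.of_isPullback (P := @QuasiCompact) hq.flip hS.2⟩
  exact MorphismProperty.of_isPullback_of_descendsAlong (P := .isomorphisms Scheme.{u})
    h.flip hq' hf

variable {k} in
theorem exists_splitting_field [PerfectField k] {S : Over (Spec (CommRingCat.of k))}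
    [LocallyOfFinitePresentation S.hom]
    (φ : (baseChange k (AlgebraicClosure k)).obj S ≅ projectivePlane (AlgebraicClosure k)) :
    ∃ (L : Type u) (_ : Field L) (_ : Algebra k L), FiniteDimensional k L ∧ IsGalois k L ∧
      Nonempty ((baseChange k L).obj S ≅ projectivePlane L) := by
  let M := AlgebraicClosure k
  have : IsGalois k M := isGalois_algebraicClosure
  let t : planeDiagram k M ⟶ (Functor.const _).obj (Spec (CommRingCat.of k)) :=
    { app := fun F => planeHom F.unop ≫ Spec.map (CommRingCat.ofHom (algebraMap k F.unop))
      naturality := fun F F' f => by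
        refine Eq.trans ?_ (Category.comp_id _).symm
        refine (Category.assoc _ _ _).symm.trans ?_
        refine (congrArg (· ≫ _) (planeExt_planeHom _)).trans ?_
        rw [Category.assoc, ← Spec.map_comp]
        rfl }
  have : ∀ {F F'} (f : F ⟶ F'), IsAffineHom ((planeDiagram k M).map f) := fun f =>
    isAffineHom_planeExt _
  have : ∀ F, CompactSpace ((planeDiagram k M).obj F) := fun F => compactSpace_plane F.unop
  have : ∀ F, QuasiSeparatedSpace ((planeDiagram k M).obj F) := fun F =>
    inferInstanceAs (QuasiSeparatedSpace (Proj (grading 2 F.unop)))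
  let a : (planeCone k M).pt ⟶ S.left := φ.inv.left ≫ Limits.pullback.fst _ _
  have ha : (planeCone k M).π ≫ t = (Functor.const _).map (a ≫ S.hom) := by
    ext F : 2
    have e : a ≫ S.hom = planeHom M ≫ Spec.map (CommRingCat.ofHom (algebraMap k M)) := by
      refine (Category.assoc _ _ _).trans ?_
      rw [Limits.pullback.condition]
      exact (Category.assoc _ _ _).symm.trans (congrArg (· ≫ _) (inv_left_comp_snd φ))
    refine Eq.trans ?_ e.symm
    refine (Category.assoc _ _ _).symm.trans ?_
    refine (congrArg (· ≫ _) (planeExt_planeHom (algebraMap F.unop M))).trans ?_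
    rw [Category.assoc, ← Spec.map_comp]
    rfl
  -- Local finite presentation of S makes the map from the limit plane factor through a finite stage
  -- F.
  obtain ⟨F, g, hg, hg'⟩ := Scheme.exists_π_app_comp_eq_of_locallyOfFinitePresentation
    (planeDiagram k M) t S.hom (planeCone k M) (isLimitPlaneCone k M) a ha
  let L := F.unop
  let g₀ : (projectivePlane L).left ⟶ S.left := g
  have hg₀ : g₀ ≫ S.hom = (projectivePlane L).hom ≫
    Spec.map (CommRingCat.ofHom (algebraMap k L)) := hg'
  have hg₁ : planeProj (algebraMap L M) ≫ g₀ = φ.inv.left ≫ Limits.pullback.fst _ _ := hg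
  let h : (projectivePlane L).left ⟶ ((baseChange k L).obj S).left :=
    Limits.pullback.lift g₀ (projectivePlane L).hom hg₀
  have h1 : h ≫ Limits.pullback.fst _ _ = g₀ := Limits.pullback.lift_fst _ _ _
  have h2 : h ≫ Limits.pullback.snd _ _ = (projectivePlane L).hom := Limits.pullback.lift_snd _ _ _
  have hP := isPullback_planeProj (algebraMap L M)
  have hX := isPullback_baseChangeProj S L M
  have hcomm : planeProj (algebraMap L M) ≫ h = φ.inv.left ≫ baseChangeProj S L M := by
    refine Limits.pullback.hom_ext ?_ ?_
    · rw [Category.assoc, Category.assoc, h1, hg₁]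
      exact congrArg _ baseChangeProj_fst.symm
    · rw [Category.assoc, Category.assoc, h2, hP.w, baseChangeProj_snd, ← Category.assoc,
        inv_left_comp_snd]
  -- The base change of h to the algebraic closure is φ⁻¹: paste this square onto the base change
  -- square of S and recognize the one of the plane.
  have hpb : IsPullback (planeProj (algebraMap L M)) φ.inv.left h (baseChangeProj S L M) := by
    refine IsPullback.of_bot (h₃₁ := Spec.map (CommRingCat.ofHom (algebraMap L M)))
      (v₂₁ := ((baseChange k M).obj S).hom) (v₂₂ := ((baseChange k L).obj S).hom) ?_ hcomm hX
    rw [Over.w]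
    have h2' : h ≫ ((baseChange k L).obj S).hom = (projectivePlane L).hom := h2
    rw [h2']
    exact hP
  have : IsIso h := isIso_of_isIso_baseChange _ _ hpb hX inferInstance
  exact ⟨L, inferInstance, inferInstance, inferInstance, inferInstance,
    ⟨(Over.isoMk (f := projectivePlane L) (g := (baseChange k L).obj S) (asIso h) h2).symm⟩⟩

end Splitting

end SeveriBrauer

theorem mainTheorem5 {k : Type u} [Field k] [PerfectField k]
    (S : Over (Spec (CommRingCat.of k))) (hS : SeveriBrauer.IsSeveriBrauerSurface S) :
    -- a finite Galois splitting field exists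
    (∃ (L : Type u) (_ : Field L) (_ : Algebra k L), FiniteDimensional k L ∧ IsGalois k L ∧
      Nonempty ((SeveriBrauer.baseChange k L).obj S ≅ SeveriBrauer.projectivePlane L)) ∧
    -- for every splitting, the matrices `B g` exist, and for every choice of them every
    -- automorphism has an affine representant, which is unique up to `k*`
    (∀ (L : Type u) [Field L] [Algebra k L] [FiniteDimensional k L] [IsGalois k L]
      (φ : (SeveriBrauer.baseChange k L).obj S ≅ SeveriBrauer.projectivePlane L),
      (∃ B : (L ≃ₐ[k] L) → GL (Fin 3) L, SeveriBrauer.RepresentsGalois φ B) ∧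
      ∀ B : (L ≃ₐ[k] L) → GL (Fin 3) L, SeveriBrauer.RepresentsGalois φ B →
        ∀ α : Aut S, ∃ A : GL (Fin 3) L, SeveriBrauer.IsAffineRepresentant φ B α A ∧
          ∀ A' : GL (Fin 3) L, SeveriBrauer.IsAffineRepresentant φ B α A' ↔
            ∃ c : kˣ, (A' : Matrix (Fin 3) (Fin 3) L) =
              algebraMap k L c • (A : Matrix (Fin 3) (Fin 3) L)) ∧
    -- the determinants of all affine representants, for all choices of `L`, `φ` and `B`, lie in
    -- `k*`, and their classes are the values of one group homomorphism
    ∃! det : Aut S →* SeveriBrauer.UnitsModCubes k,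
      ∀ (L : Type u) [Field L] [Algebra k L] [FiniteDimensional k L] [IsGalois k L]
        (φ : (SeveriBrauer.baseChange k L).obj S ≅ SeveriBrauer.projectivePlane L)
        (B : (L ≃ₐ[k] L) → GL (Fin 3) L), SeveriBrauer.RepresentsGalois φ B →
        ∀ (α : Aut S) (A : GL (Fin 3) L), SeveriBrauer.IsAffineRepresentant φ B α A →
          ∃ d : kˣ, algebraMap k L d = (A : Matrix (Fin 3) (Fin 3) L).det ∧
            det α = QuotientGroup.mk d := by
  obtain ⟨φ⟩ := hS.geometricallyPlane
  have : SmoothOfRelativeDimension 2 S.hom := hS.smooth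
  -- Smoothness supplies the local finite presentation needed for the splitting field.
  have : Smooth S.hom := SmoothOfRelativeDimension.smooth 2 S.hom
  have h0 := SeveriBrauer.exists_splitting_field φ
  refine ⟨h0, ?_, ?_⟩
  · intro L _ _ _ _ φ
    refine ⟨SeveriBrauer.exists_representsGalois φ, fun B hB α => ?_⟩
    obtain ⟨A, hA⟩ := SeveriBrauer.exists_isAffineRepresentant hB α
    refine ⟨A, hA, fun A' => (hA.iff_smul A').trans (exists_congr fun c => ?_)⟩
    rw [← Units.val_inj, Units.val_mul, Matrix.GeneralLinearGroup.coe_scalar, Matrix.scalar_apply,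
      Matrix.smul_eq_diagonal_mul]
    rfl
  · obtain ⟨L, _, _, _, _, ⟨φ⟩⟩ := h0
    exact SeveriBrauer.existsUnique_det φ
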